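/- Let $\mathbb K$ be a field and let $\mathbf{Op}$ be the category of finitely generated binary quadratic symmetric operads in $\mathbb K$-vector spaces, i.e. operads presented by a finite-dimensional space $E$ of binary generators with an action of $S_2$ and by relations in arity $3$; its morphisms are the morphisms of operads. *The Manin white product.* For $\mathcal P,\mathcal O\in\mathbf{Op}$, the operad $\mathcal P\circ\mathcal O\in\mathbf{Op}$ is generated by $\mathcal P(2)\otimes\mathcal O(2)$, with relations the kernel of the natural map $\mathcal F(\mathcal P(2)\otimes\mathcal O(2))(3)\to\mathcal P(3)\otimes\mathcal O(3)$, where $\mathcal F$ denotes the free operad. This gives in particular the functor $\mathcal Lie\circ-:\mathbf{Op}\to\mathbf{Op}$, where $\mathcal Lie$ is the operad generated by one antisymmetric bracket with the Jacobi relation. *The functor $\operatorname{Lie}_\circ$.* For a vector space $V$ let $C^*(\Delta_1;V)=C^*(\Delta_1;\mathbb K)\otimes V$ be the complex of non-degenerate $V$-valued cochains on the standard $1$-simplex. If $V$ is an $\mathcal O$-algebra, each binary operation $m\in\mathcal O(2)$ induces a cup bracket $(\cup-\cup^{op})\otimes m$ on $C^*(\Delta_1;V)$, where $\cup$ is the cup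 product of $C^*(\Delta_1;\mathbb K)$. The operad $\operatorname{Lie}_\circ(\mathcal O)\in\mathbf{Op}$ is generated by the cup brackets, that is, by the $S_2$-module $\operatorname{sgn}\otimes\mathcal O(2)$ (so non-symmetric, symmetric and antisymmetric generators of $\mathcal O$ give respectively non-symmetric, antisymmetric and symmetric generators), together with the largest space of relations in arity $3$ such that, for every $\mathcal O$-algebra $V$, the complex $C^*(\Delta_1;V)$ with the cup brackets is a local dg $\operatorname{Lie}_\circ(\mathcal O)$-algebra, i.e. a dg algebra in which, for every closed subset $X\subset\Delta_1$, the relative cochains $C^*(\Delta_1,X;V)$ form a dg ideal. A morphism $f$ of operads induces $\operatorname{Lie}_\circ(f)$ by sending the cup bracket of $m$ to the cup bracket of $f(m)$. **Theorem.** There is a natural isomorphism $\operatorname{Lie}_\circ(-)\xrightarrow{\ \cong\ }\mathcal Lie\circ-$ of functors $\mathbf{Op}\to\mathbf{Op}$. -/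

import Mathlib

open CategoryTheory
open scoped TensorProduct

universe u

namespace Manin

/-! ### Symmetric operads in vector spaces -/

/-- A symmetric operad in `K`-vector spaces, with arities indexed by finite sets: `obj A` is the
space of operations whose inputs are labelled by `A`, bijections act by relabelling the inputs, and
`comp A p q` plugs, for each `b : B`, the output of `q b` into the input `b` of `p`. -/
structure SymOperad (K : Type u) [Field K] where
  obj : (A : Type) → [Finite A] → Type u
  [grp : ∀ (A : Type) [Finite A], AddCommGroup (obj A)]
  [mod : ∀ (A : Type) [Finite A], Module K (obj A)]
  map : ∀ {A B : Type} [Finite A] [Finite B], A ≃ B → obj A →ₗ[K] obj B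
  one : obj Unit
  comp : ∀ {B : Type} [Finite B] (A : B → Type) [∀ b, Finite (A b)],
    obj B →ₗ[K] MultilinearMap K (fun b => obj (A b)) (obj (Σ b, A b))
  map_refl : ∀ {A : Type} [Finite A] (p : obj A), map (Equiv.refl A) p = p
  map_trans : ∀ {A B C : Type} [Finite A] [Finite B] [Finite C] (σ : A ≃ B) (τ : B ≃ C)
    (p : obj A), map (σ.trans τ) p = map τ (map σ p)
  one_comp : ∀ (A : Unit → Type) [∀ b, Finite (A b)] (q : ∀ b, obj (A b)),
    comp A one q = map (Equiv.uniqueSigma A).symm (q ())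
  comp_one : ∀ {B : Type} [Finite B] (p : obj B),
    comp (fun _ => Unit) p (fun _ => one) = map (Equiv.sigmaUnique B (fun _ => Unit)).symm p
  comp_assoc : ∀ {C : Type} [Finite C] (B : C → Type) [∀ c, Finite (B c)]
    (A : ∀ c, B c → Type) [∀ c b, Finite (A c b)]
    (p : obj C) (q : ∀ c, obj (B c)) (r : ∀ c b, obj (A c b)),
    map (Equiv.sigmaAssoc A)
        (comp (fun x : Σ c, B c => A x.1 x.2) (comp B p q) (fun x => r x.1 x.2)) =
      comp (fun c => Σ b, A c b) p (fun c => comp (A c) (q c) (r c))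
  comp_map_left : ∀ {B B' : Type} [Finite B] [Finite B'] (σ : B ≃ B') (A : B' → Type)
    [∀ b, Finite (A b)] (p : obj B) (q : ∀ b, obj (A b)),
    comp A (map σ p) q =
      map (Equiv.sigmaCongrLeft σ) (comp (fun b => A (σ b)) p (fun b => q (σ b)))
  comp_map_right : ∀ {B : Type} [Finite B] (A A' : B → Type) [∀ b, Finite (A b)]
    [∀ b, Finite (A' b)] (σ : ∀ b, A b ≃ A' b) (p : obj B) (q : ∀ b, obj (A b)),
    comp A' p (fun b => map (σ b) (q b)) = map (Equiv.sigmaCongrRight σ) (comp A p q)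

attribute [instance] SymOperad.grp SymOperad.mod

namespace SymOperad

variable {K : Type u} [Field K]

/-- Morphisms of operads. -/
@[ext]
structure Hom (P Q : SymOperad K) where
  app : ∀ (A : Type) [Finite A], P.obj A →ₗ[K] Q.obj A
  app_map : ∀ {A B : Type} [Finite A] [Finite B] (σ : A ≃ B) (p : P.obj A),
    app B (P.map σ p) = Q.map σ (app A p)
  app_one : app Unit P.one = Q.one
  app_comp : ∀ {B : Type} [Finite B] (A : B → Type) [∀ b, Finite (A b)] (p : P.obj B)
    (q : ∀ b, P.obj (A b)),
    app (Σ b, A b) (P.comp A p q) = Q.comp A (app B p) (fun b => app (A b) (q b))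

instance : Category (SymOperad K) where
  Hom := Hom
  id P :=
    { app := fun _ _ => LinearMap.id
      app_map := fun _ _ => rfl
      app_one := rfl
      app_comp := fun _ _ _ _ => rfl }
  comp f g :=
    { app := fun A _ => g.app A ∘ₗ f.app A
      app_map := fun σ p => by simp [f.app_map, g.app_map]
      app_one := by simp [f.app_one, g.app_one]
      app_comp := fun A _ p q => by simp [f.app_comp, g.app_comp] }

@[simp] theorem id_app (P : SymOperad K) (A : Type) [Finite A] (p : P.obj A) :
    Hom.app (𝟙 P) A p = p := rfl

@[simp] theorem comp_app {P Q R : SymOperad K} (f : P ⟶ Q) (g : Q ⟶ R) (A : Type) [Finite A]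
    (p : P.obj A) : Hom.app (f ≫ g) A p = g.app A (f.app A p) := rfl

/-- The structure of an algebra over the operad `P` on a vector space `V`. -/
structure Alg (P : SymOperad K) (V : Type u) [AddCommGroup V] [Module K V] where
  act : ∀ {A : Type} [Finite A], P.obj A →ₗ[K] MultilinearMap K (fun _ : A => V) V
  act_one : ∀ v : Unit → V, act P.one v = v ()
  act_map : ∀ {A B : Type} [Finite A] [Finite B] (σ : A ≃ B) (p : P.obj A) (v : B → V),
    act (P.map σ p) v = act p (fun a => v (σ a))
  act_comp : ∀ {B : Type} [Finite B] (A : B → Type) [∀ b, Finite (A b)] (p : P.obj B)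
    (q : ∀ b, P.obj (A b)) (v : (Σ b, A b) → V),
    act (P.comp A p q) v = act p (fun b => act (q b) (fun a => v ⟨b, a⟩))

/-- Restriction of an algebra structure along a morphism of operads. -/
def Alg.restrict {P Q : SymOperad K} (f : P ⟶ Q) {V : Type u} [AddCommGroup V] [Module K V]
    (a : Q.Alg V) : P.Alg V where
  act := fun {A} _ => a.act ∘ₗ f.app A
  act_one v := by simp [f.app_one, a.act_one]
  act_map σ p v := by simp [f.app_map, a.act_map]
  act_comp A _ p q v := by simp [f.app_comp, a.act_comp]

theorem update_pair_zero {V : Type u} (x y z : V) :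
    Function.update ![x, y] 0 z = ![z, y] := by
  funext i
  fin_cases i <;> rfl

theorem update_pair_one {V : Type u} (x y z : V) :
    Function.update ![x, y] 1 z = ![x, z] := by
  funext i
  fin_cases i <;> rfl

/-- The binary operations of a `P`-algebra: `p` acts by `x, y ↦ p(x, y)`. -/
def Alg.bin {P : SymOperad K} {V : Type u} [AddCommGroup V] [Module K V] (a : P.Alg V) :
    P.obj (Fin 2) →ₗ[K] V →ₗ[K] V →ₗ[K] V where
  toFun p := LinearMap.mk₂ K (fun x y => a.act p ![x, y])
    (fun x x' y => by
      have h := (a.act p).map_update_add ![x, y] 0 x x'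
      simpa only [update_pair_zero] using h)
    (fun c x y => by
      have h := (a.act p).map_update_smul ![x, y] 0 c x
      simpa only [update_pair_zero] using h)
    (fun x y y' => by
      have h := (a.act p).map_update_add ![x, y] 1 y y'
      simpa only [update_pair_one] using h)
    (fun c x y => by
      have h := (a.act p).map_update_smul ![x, y] 1 c y
      simpa only [update_pair_one] using h)
  map_add' p q := by ext x y; simp
  map_smul' c p := by ext x y; simp

/-- The action of the transposition on binary operations, `p ↦ p^op`. -/
def swap (P : SymOperad K) : P.obj (Fin 2) →ₗ[K] P.obj (Fin 2) := P.map (Equiv.swap 0 1)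

theorem swap_swap (P : SymOperad K) (p : P.obj (Fin 2)) : P.swap (P.swap p) = p := by
  rw [swap, ← P.map_trans]
  have : (Equiv.swap (0 : Fin 2) 1).trans (Equiv.swap 0 1) = Equiv.refl _ := by
    ext i; simp
  rw [this, P.map_refl]

/-- The input sets used for `μ(ν(-, -), -)`. -/
def slot : Fin 2 → Type
  | 0 => Fin 2
  | 1 => Unit

instance : ∀ b, Finite (slot b)
  | 0 => inferInstanceAs (Finite (Fin 2))
  | 1 => inferInstanceAs (Finite Unit)

/-- The inputs of `μ(ν(-, -), -)` are labelled, in this order, by `i, i + 1, i + 2` modulo `3`. -/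
def slotFun (i : Fin 3) : (Σ b, slot b) → Fin 3
  | ⟨0, a⟩ => i + Fin.castSucc (n := 2) a
  | ⟨1, _⟩ => i + 2

theorem slotFun_bijective (i : Fin 3) : Function.Bijective (slotFun i) := by
  constructor
  · have h1 : ∀ (i : Fin 3) (a a' : Fin 2),
        i + Fin.castSucc a = i + Fin.castSucc a' → a = a' := by decide
    have h2 : ∀ (i : Fin 3) (a : Fin 2), i + Fin.castSucc a ≠ i + 2 := by decide
    rintro ⟨b, a⟩ ⟨b', a'⟩ h
    match b, a, b', a', h with
    | 0, a, 0, a', h => exact congrArg (Sigma.mk (β := slot) 0) (h1 i a a' h)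
    | 0, a, 1, _, h => exact absurd h (h2 i a)
    | 1, _, 0, a', h => exact absurd h.symm (h2 i a')
    | 1, _, 1, _, _ => rfl
  · intro j
    have h : j = i + Fin.castSucc (n := 2) 0 ∨ j = i + Fin.castSucc (n := 2) 1 ∨ j = i + 2 := by
      revert i j; decide
    rcases h with h | h | h
    · exact ⟨⟨0, (0 : Fin 2)⟩, h.symm⟩
    · exact ⟨⟨0, (1 : Fin 2)⟩, h.symm⟩
    · exact ⟨⟨1, ()⟩, h.symm⟩

noncomputable def slotEquiv (i : Fin 3) : (Σ b, slot b) ≃ Fin 3 :=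
  Equiv.ofBijective (slotFun i) (slotFun_bijective i)

/-- The operation `ν` in the first slot and the identity in the second one. -/
def slotOps (P : SymOperad K) (ν : P.obj (Fin 2)) : ∀ b, P.obj (slot b)
  | 0 => ν
  | 1 => P.one

theorem slotOps_eq_update (P : SymOperad K) (ν : P.obj (Fin 2)) :
    P.slotOps ν = Function.update (P.slotOps 0) 0 ν := by
  funext b
  match b with
  | 0 => rfl
  | 1 => rfl

/-- The ternary composite `μ(ν(x_i, x_{i+1}), x_{i+2})` (indices modulo `3`). -/
noncomputable def circ (P : SymOperad K) (i : Fin 3) :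
    P.obj (Fin 2) →ₗ[K] P.obj (Fin 2) →ₗ[K] P.obj (Fin 3) :=
  LinearMap.mk₂ K (fun μ ν => P.map (slotEquiv i) (P.comp slot μ (P.slotOps ν)))
    (fun μ μ' ν => by simp)
    (fun c μ ν => by simp)
    (fun μ ν ν' => by
      have h := (P.comp slot μ).map_update_add (P.slotOps 0) 0 ν ν'
      rw [P.slotOps_eq_update (ν + ν'), P.slotOps_eq_update ν, P.slotOps_eq_update ν', ← map_add]
      exact congrArg (P.map (slotEquiv i)) h)
    (fun c μ ν => by
      have h := (P.comp slot μ).map_update_smul (P.slotOps 0) 0 c ν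
      rw [P.slotOps_eq_update (c • ν), P.slotOps_eq_update ν, ← map_smul]
      exact congrArg (P.map (slotEquiv i)) h)

theorem Hom.app_swap {P Q : SymOperad K} (f : P ⟶ Q) (p : P.obj (Fin 2)) :
    f.app _ (P.swap p) = Q.swap (f.app _ p) := f.app_map _ _

theorem Hom.app_circ {P Q : SymOperad K} (f : P ⟶ Q) (i : Fin 3) (μ ν : P.obj (Fin 2)) :
    f.app _ (P.circ i μ ν) = Q.circ i (f.app _ μ) (f.app _ ν) := by
  simp only [circ, LinearMap.mk₂_apply]
  rw [f.app_map, f.app_comp]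
  congr 2
  funext b
  match b with
  | 0 => rfl
  | 1 => exact f.app_one

end SymOperad

/-! ### Binary quadratic presentations -/

variable {K : Type u} [Field K]

section Tern

variable {E E' V W : Type u} [AddCommGroup E] [Module K E] [AddCommGroup E'] [Module K E']
  [AddCommGroup V] [Module K V] [AddCommGroup W] [Module K W]

/-- For a space `E` of binary operations with an action of the transposition, the arity `3` part of
the free operad on `E` is the sum of three copies of `E ⊗ E`: the tensor `μ ⊗ ν` in the copy of index
`i` stands for the operation `μ(ν(x_i, x_{i+1}), x_{i+2})`, with indices modulo `3`. -/
abbrev Tern (K : Type u) [Field K] (E : Type u) [AddCommGroup E] [Module K E] : Type u :=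
  Fin 3 → E ⊗[K] E

/-- The functoriality of `Tern`. -/
noncomputable def ternMap (f : E →ₗ[K] E') : Tern K E →ₗ[K] Tern K E' :=
  LinearMap.pi fun i => TensorProduct.map f f ∘ₗ LinearMap.proj i

/-- `μ ⊗ ν ↦ μ(ν(x_i, x_{i+1}), x_{i+2})`, for binary operations on `V` indexed by `E`. -/
noncomputable def ternTerm (op : E →ₗ[K] V →ₗ[K] V →ₗ[K] V) (x : Fin 3 → V) (i : Fin 3) :
    E ⊗[K] E →ₗ[K] V :=
  TensorProduct.lift (LinearMap.mk₂ K
    (fun μ ν => op μ (op ν (x i) (x (i + 1))) (x (i + 2)))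
    (fun _ _ _ => by simp) (fun _ _ _ => by simp) (fun _ _ _ => by simp) (fun _ _ _ => by simp))

/-- The value at `x 0, x 1, x 2` of a ternary operation. -/
noncomputable def ternEval (op : E →ₗ[K] V →ₗ[K] V →ₗ[K] V) (x : Fin 3 → V) :
    Tern K E →ₗ[K] V :=
  ∑ i, ternTerm op x i ∘ₗ LinearMap.proj i

theorem ternTerm_map (f : E →ₗ[K] E') (φ : V →ₗ[K] W) (op : E →ₗ[K] V →ₗ[K] V →ₗ[K] V)
    (op' : E' →ₗ[K] W →ₗ[K] W →ₗ[K] W)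
    (h : ∀ e a b, φ (op e a b) = op' (f e) (φ a) (φ b)) (x : Fin 3 → V) (i : Fin 3)
    (r : E ⊗[K] E) :
    φ (ternTerm op x i r) = ternTerm op' (fun j => φ (x j)) i (TensorProduct.map f f r) := by
  have : φ ∘ₗ ternTerm op x i =
      ternTerm op' (fun j => φ (x j)) i ∘ₗ TensorProduct.map f f := by
    apply TensorProduct.ext'
    intro μ ν
    simp [ternTerm, h]
  exact LinearMap.congr_fun this r

theorem ternEval_map (f : E →ₗ[K] E') (φ : V →ₗ[K] W) (op : E →ₗ[K] V →ₗ[K] V →ₗ[K] V)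
    (op' : E' →ₗ[K] W →ₗ[K] W →ₗ[K] W)
    (h : ∀ e a b, φ (op e a b) = op' (f e) (φ a) (φ b)) (x : Fin 3 → V) (r : Tern K E) :
    φ (ternEval op x r) = ternEval op' (fun j => φ (x j)) (ternMap f r) := by
  simp [ternEval, ternMap, ternTerm_map f φ op op' h]

@[simp] theorem ternMap_id (r : Tern K E) : ternMap (LinearMap.id : E →ₗ[K] E) r = r := by
  funext i; simp [ternMap]

end Tern

/-- Binary quadratic data: a space `E` of generating binary operations with an action of the
symmetric group `S_2` (given by the involution `swap`, sending an operation to the opposite one) and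
a space of relations between the ternary composites of the generators. -/
structure QuadData (K : Type u) [Field K] where
  E : Type u
  [grp : AddCommGroup E]
  [mod : Module K E]
  swap : E →ₗ[K] E
  swap_swap : ∀ e, swap (swap e) = e
  rel : Submodule K (Tern K E)

attribute [instance] QuadData.grp QuadData.mod

namespace QuadData

/-- Morphisms of binary quadratic data. -/
@[ext]
structure Hom (D D' : QuadData K) where
  lin : D.E →ₗ[K] D'.E
  lin_swap : ∀ e, lin (D.swap e) = D'.swap (lin e)
  lin_rel : ∀ r ∈ D.rel, ternMap lin r ∈ D'.rel

theorem ternMap_comp_apply {E E' E'' : Type u} [AddCommGroup E] [Module K E] [AddCommGroup E']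
    [Module K E'] [AddCommGroup E''] [Module K E''] (f : E →ₗ[K] E') (g : E' →ₗ[K] E'')
    (r : Tern K E) : ternMap (g ∘ₗ f) r = ternMap g (ternMap f r) := by
  funext i; simp [ternMap, TensorProduct.map_comp]

instance : Category (QuadData K) where
  Hom := Hom
  id D :=
    { lin := LinearMap.id
      lin_swap := fun _ => rfl
      lin_rel := fun r h => by simpa using h }
  comp f g :=
    { lin := g.lin ∘ₗ f.lin
      lin_swap := fun e => by simp [f.lin_swap, g.lin_swap]
      lin_rel := fun r h => by
        rw [ternMap_comp_apply]; exact g.lin_rel _ (f.lin_rel _ h) }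

@[simp] theorem id_lin (D : QuadData K) (e : D.E) : Hom.lin (𝟙 D) e = e := rfl

@[simp] theorem comp_lin {D D' D'' : QuadData K} (f : D ⟶ D') (g : D' ⟶ D'') (e : D.E) :
    Hom.lin (f ≫ g) e = g.lin (f.lin e) := rfl

/-- Algebras of the type given by `D`: vector spaces with binary operations indexed linearly and
equivariantly by `D.E` and satisfying the relations. -/
structure Model (D : QuadData K) (V : Type u) [AddCommGroup V] [Module K V] where
  op : D.E →ₗ[K] V →ₗ[K] V →ₗ[K] V
  op_swap : ∀ e x y, op (D.swap e) x y = op e y x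
  op_rel : ∀ r ∈ D.rel, ∀ x : Fin 3 → V, ternEval op x r = 0

/-- Restriction along a morphism of quadratic data. -/
def Model.restrict {D D' : QuadData K} (f : D ⟶ D') {V : Type u} [AddCommGroup V] [Module K V]
    (a : D'.Model V) : D.Model V where
  op := a.op ∘ₗ f.lin
  op_swap e x y := by simp [f.lin_swap, a.op_swap]
  op_rel r hr x := by
    have h := ternEval_map f.lin LinearMap.id (a.op ∘ₗ f.lin) a.op (fun _ _ _ => rfl) x r
    simp only [LinearMap.id_coe, id_eq] at h
    rw [h]
    exact a.op_rel _ (f.lin_rel r hr) _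

/-- Formal iterated binary operations in variables `X`. -/
inductive Term (E : Type u) (X : Type) : Type u
  | var : X → Term E X
  | node : E → Term E X → Term E X → Term E X

/-- The value of a formal operation. -/
def Term.eval {E V : Type u} [AddCommGroup E] [Module K E] [AddCommGroup V] [Module K V]
    {X : Type} (op : E →ₗ[K] V →ₗ[K] V →ₗ[K] V) (v : X → V) : Term E X → V
  | .var x => v x
  | .node e t s => op e (t.eval op v) (s.eval op v)

/-- `t.IsLin S`: the variables occurring in `t` are those in `S`, each of them exactly once. -/
inductive Term.IsLin {E : Type u} {X : Type} : Set X → Term E X → Prop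
  | var (x : X) : Term.IsLin {x} (Term.var x)
  | node (e : E) {S T : Set X} {t s : Term E X} (h : Disjoint S T) (ht : Term.IsLin S t)
      (hs : Term.IsLin T s) : Term.IsLin (S ∪ T) (Term.node e t s)

variable (D : QuadData K)

/-- The linear combinations of formal operations which vanish identically in all algebras of the
type given by `D`. -/
def identities (X : Type) : Submodule K (Term D.E X →₀ K) where
  carrier := {m | ∀ (V : Type u) [AddCommGroup V] [Module K V] (a : D.Model V) (v : X → V),
    Finsupp.linearCombination K (fun t : Term D.E X => t.eval a.op v) m = 0}
  zero_mem' := fun _ _ _ _ _ => map_zero _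
  add_mem' := by
    intro m m' h h' V _ _ a v
    rw [map_add, h V a v, h' V a v, add_zero]
  smul_mem' := by
    intro c m h V _ _ a v
    rw [map_smul, h V a v, smul_zero]

/-- The free algebra on `X` of the type given by `D`. -/
abbrev Free (X : Type) : Type u := (Term D.E X →₀ K) ⧸ D.identities X

variable {D}

namespace Free

variable {X Y : Type} {V W : Type u} [AddCommGroup V] [Module K V] [AddCommGroup W] [Module K W]

/-- The class of a formal operation. -/
noncomputable def term (t : Term D.E X) : D.Free X :=
  (D.identities X).mkQ (Finsupp.single t 1)

/-- The generators of the free algebra. -/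
noncomputable def var (x : X) : D.Free X := term (Term.var x)

/-- The morphism from the free algebra with prescribed values on the generators. -/
noncomputable def lift (a : D.Model V) (v : X → V) : D.Free X →ₗ[K] V :=
  (D.identities X).liftQ (Finsupp.linearCombination K (fun t : Term D.E X => t.eval a.op v))
    (fun _ h => h V a v)

@[simp] theorem lift_term (a : D.Model V) (v : X → V) (t : Term D.E X) :
    lift a v (term t) = t.eval a.op v := by
  change Finsupp.linearCombination K (fun t : Term D.E X => t.eval a.op v) _ = _
  simp

@[simp] theorem lift_var (a : D.Model V) (v : X → V) (x : X) : lift a v (var x) = v x :=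
  lift_term a v _

theorem ext {p q : D.Free X}
    (h : ∀ (V : Type u) [AddCommGroup V] [Module K V] (a : D.Model V) (v : X → V),
      lift a v p = lift a v q) : p = q := by
  obtain ⟨p, rfl⟩ := (D.identities X).mkQ_surjective p
  obtain ⟨q, rfl⟩ := (D.identities X).mkQ_surjective q
  simp only [Submodule.mkQ_apply]
  rw [Submodule.Quotient.eq]
  intro V _ _ a v
  have h' : Finsupp.linearCombination K (fun t : Term D.E X => t.eval a.op v) p =
    Finsupp.linearCombination K (fun t : Term D.E X => t.eval a.op v) q := h V a v
  rw [map_sub, h', sub_self]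

theorem span_term : Submodule.span K (Set.range (term : Term D.E X → D.Free X)) = ⊤ := by
  rw [eq_top_iff]
  rintro p -
  obtain ⟨p, rfl⟩ := (D.identities X).mkQ_surjective p
  induction p using Finsupp.induction_linear with
  | zero => simp
  | add p q hp hq => rw [map_add]; exact Submodule.add_mem _ hp hq
  | single t c =>
    have : Finsupp.single t c = c • Finsupp.single t (1 : K) := by simp
    rw [this, map_smul]
    exact Submodule.smul_mem _ _ (Submodule.subset_span ⟨t, rfl⟩)

/-- The bilinear extension of `t, s ↦ node e t s` to linear combinations. -/
noncomputable def preOp (e : D.E) :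
    (Term D.E X →₀ K) →ₗ[K] (Term D.E X →₀ K) →ₗ[K] (Term D.E X →₀ K) :=
  Finsupp.linearCombination K (fun t => Finsupp.linearCombination K
    (fun s => Finsupp.single (Term.node e t s) 1))

theorem eval_preOp (a : D.Model V) (v : X → V) (e : D.E) (p q : Term D.E X →₀ K) :
    Finsupp.linearCombination K (fun t : Term D.E X => t.eval a.op v) (preOp e p q) =
      a.op e (Finsupp.linearCombination K (fun t : Term D.E X => t.eval a.op v) p)
        (Finsupp.linearCombination K (fun t : Term D.E X => t.eval a.op v) q) := by
  induction p using Finsupp.induction_linear with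
  | zero => simp
  | add p p' hp hp' => simp only [map_add, LinearMap.add_apply, hp, hp']
  | single t c =>
    induction q using Finsupp.induction_linear with
    | zero => simp
    | add q q' hq hq' => simp only [map_add, hq, hq']
    | single s c' =>
      simp only [preOp, Finsupp.linearCombination_single, LinearMap.smul_apply, map_smul, one_smul]
      simp only [Term.eval]
      rw [smul_comm]

/-- The operations of the free algebra. -/
noncomputable def opFun (e : D.E) (p q : D.Free X) : D.Free X :=
  (D.identities X).mkQ (preOp e (Quotient.out p) (Quotient.out q))

theorem lift_opFun (a : D.Model V) (v : X → V) (e : D.E) (p q : D.Free X) :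
    lift a v (opFun e p q) = a.op e (lift a v p) (lift a v q) := by
  have hp : (D.identities X).mkQ (Quotient.out p) = p := Quotient.out_eq p
  have hq : (D.identities X).mkQ (Quotient.out q) = q := Quotient.out_eq q
  conv_rhs => rw [← hp, ← hq]
  exact eval_preOp a v e _ _

/-- The free algebra as an algebra of the type given by `D`. -/
noncomputable def model (D : QuadData K) (X : Type) : D.Model (D.Free X) :=
  let op : D.E →ₗ[K] D.Free X →ₗ[K] D.Free X →ₗ[K] D.Free X :=
    { toFun := fun e => LinearMap.mk₂ K (opFun e)
        (fun _ _ _ => ext fun V _ _ a v => by simp [lift_opFun])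
        (fun _ _ _ => ext fun V _ _ a v => by simp [lift_opFun])
        (fun _ _ _ => ext fun V _ _ a v => by simp [lift_opFun])
        (fun _ _ _ => ext fun V _ _ a v => by simp [lift_opFun])
      map_add' := fun e e' => LinearMap.ext₂ fun x y => ext fun V _ _ a v => by
        simp [lift_opFun]
      map_smul' := fun c e => LinearMap.ext₂ fun x y => ext fun V _ _ a v => by
        simp [lift_opFun] }
  { op := op
    op_swap := fun e x y => ext fun V _ _ a v => by
      change lift a v (opFun _ _ _) = lift a v (opFun _ _ _)
      rw [lift_opFun, lift_opFun, a.op_swap]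
    op_rel := fun r hr x => ext fun V _ _ a v => by
      rw [ternEval_map LinearMap.id (lift a v) op a.op (fun e p q => lift_opFun a v e p q),
        ternMap_id, a.op_rel r hr, map_zero] }

@[simp] theorem lift_op (a : D.Model V) (v : X → V) (e : D.E) (p q : D.Free X) :
    lift a v ((model D X).op e p q) = a.op e (lift a v p) (lift a v q) :=
  lift_opFun a v e p q

theorem op_term (e : D.E) (t s : Term D.E X) :
    (model D X).op e (term t) (term s) = term (Term.node e t s) :=
  ext fun V _ _ a v => by simp [Term.eval]

theorem hom_ext {φ ψ : D.Free X →ₗ[K] V} (op : D.E →ₗ[K] V →ₗ[K] V →ₗ[K] V)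
    (hφ : ∀ e p q, φ ((model D X).op e p q) = op e (φ p) (φ q))
    (hψ : ∀ e p q, ψ ((model D X).op e p q) = op e (ψ p) (ψ q))
    (h : ∀ x, φ (var x) = ψ (var x)) : φ = ψ := by
  apply LinearMap.ext_on_range span_term
  intro t
  induction t with
  | var x => exact h x
  | node e t s ht hs => rw [← op_term, hφ, hψ, ht, hs]

theorem lift_lift (a : D.Model V) (w : Y → V) (g : X → D.Free Y) (p : D.Free X) :
    lift a w (lift (model D Y) g p) = lift a (fun x => lift a w (g x)) p := by
  have : lift a w ∘ₗ lift (model D Y) g = lift a (fun x => lift a w (g x)) :=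
    hom_ext a.op (by simp) (by simp) (by simp)
  exact LinearMap.congr_fun this p

theorem lift_var_self (p : D.Free X) : lift (model D X) var p = p := by
  have : lift (model D X) var = LinearMap.id :=
    hom_ext (model D X).op (by simp) (by simp) (by simp)
  exact LinearMap.congr_fun this p

/-- Renaming of variables. -/
noncomputable def rename (f : X → Y) : D.Free X →ₗ[K] D.Free Y :=
  lift (model D Y) (fun x => var (f x))

@[simp] theorem rename_var (f : X → Y) (x : X) :
    rename f (var x : D.Free X) = var (f x) := lift_var _ _ _

theorem lift_rename (a : D.Model V) (w : Y → V) (f : X → Y) (p : D.Free X) :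
    lift a w (rename f p) = lift a (fun x => w (f x)) p := by
  rw [rename, lift_lift]; simp

theorem rename_lift {Z : Type} (f : Y → Z) (g : X → D.Free Y) (p : D.Free X) :
    rename f (lift (model D Y) g p) = lift (model D Z) (fun x => rename f (g x)) p :=
  lift_lift _ _ _ _

theorem rename_rename {Z : Type} (f : X → Y) (g : Y → Z) (p : D.Free X) :
    rename g (rename f p) = rename (fun x => g (f x)) p := lift_rename _ _ _ _

/-! Multilinear operations -/

/-- The span of the formal operations in which exactly the variables in `S` occur, each once. -/
noncomputable def lin (D : QuadData K) {X : Type} (S : Set X) : Submodule K (D.Free X) :=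
  Submodule.span K {p | ∃ t : Term D.E X, t.IsLin S ∧ p = term t}

theorem term_mem_lin {S : Set X} {t : Term D.E X} (h : t.IsLin S) : term t ∈ lin D S :=
  Submodule.subset_span ⟨t, h, rfl⟩

theorem op_mem_lin {S T : Set X} (h : Disjoint S T) (e : D.E) {p q : D.Free X}
    (hp : p ∈ lin D S) (hq : q ∈ lin D T) : (model D X).op e p q ∈ lin D (S ∪ T) := by
  induction hp using Submodule.span_induction with
  | zero => simp
  | add p p' _ _ hp hp' => simpa using Submodule.add_mem _ hp hp'
  | smul c p _ hp => simpa using Submodule.smul_mem _ c hp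
  | mem p hp =>
    obtain ⟨t, ht, rfl⟩ := hp
    induction hq using Submodule.span_induction with
    | zero => simp
    | add q q' _ _ hq hq' => simpa using Submodule.add_mem _ hq hq'
    | smul c q _ hq => simpa using Submodule.smul_mem _ c hq
    | mem q hq =>
      obtain ⟨s, hs, rfl⟩ := hq
      rw [op_term]
      exact term_mem_lin (ht.node e h hs)

theorem eval_mem_lin (T : X → Set Y) (hT : Pairwise (fun x x' => Disjoint (T x) (T x')))
    (v : X → D.Free Y) (hv : ∀ x, v x ∈ lin D (T x)) {S : Set X} {t : Term D.E X}
    (h : t.IsLin S) : t.eval (model D Y).op v ∈ lin D (⋃ x ∈ S, T x) := by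
  induction h with
  | var x => simpa [Term.eval] using hv x
  | node e hST _ _ ht hs =>
    rw [Set.biUnion_union]
    refine op_mem_lin ?_ e ht hs
    simp only [Set.disjoint_iUnion_left, Set.disjoint_iUnion_right]
    intro x hx y hy
    exact hT (fun hxy => Set.disjoint_left.mp hST hy (hxy ▸ hx))

theorem lift_mem_lin (T : X → Set Y) (hT : Pairwise (fun x x' => Disjoint (T x) (T x')))
    (v : X → D.Free Y) (hv : ∀ x, v x ∈ lin D (T x)) {S : Set X} {p : D.Free X}
    (h : p ∈ lin D S) : lift (model D Y) v p ∈ lin D (⋃ x ∈ S, T x) := by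
  induction h using Submodule.span_induction with
  | zero => simp
  | add p p' _ _ hp hp' => rw [map_add]; exact Submodule.add_mem _ hp hp'
  | smul c p _ hp => rw [map_smul]; exact Submodule.smul_mem _ c hp
  | mem p hp =>
    obtain ⟨t, ht, rfl⟩ := hp
    rw [lift_term]
    exact eval_mem_lin T hT v hv ht

theorem rename_mem_lin (f : X → Y) (hf : Function.Injective f) {S : Set X} {p : D.Free X}
    (h : p ∈ lin D S) : rename f p ∈ lin D (f '' S) := by
  have := lift_mem_lin (D := D) (fun x => {f x})
    (fun x y hxy => by simpa using fun h => hxy (hf h)) (fun x => var (f x))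
    (fun x => term_mem_lin (Term.IsLin.var _)) h
  have e : (⋃ x ∈ S, ({f x} : Set Y)) = f '' S := by ext; simp [eq_comm]
  rwa [e] at this

theorem eval_update_of_notMem [DecidableEq X] (op : D.E →ₗ[K] V →ₗ[K] V →ₗ[K] V) (v : X → V)
    {S : Set X} {t : Term D.E X} (h : t.IsLin S) {x : X} (hx : x ∉ S) (y : V) :
    t.eval op (Function.update v x y) = t.eval op v := by
  induction h with
  | var z =>
    have : z ≠ x := fun h => hx (by simp [h])
    simp [Term.eval, this]
  | node e _ _ _ ht hs =>
    simp only [Set.mem_union, not_or] at hx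
    simp only [Term.eval, ht hx.1, hs hx.2]

theorem eval_update_add [DecidableEq X] (op : D.E →ₗ[K] V →ₗ[K] V →ₗ[K] V) (v : X → V)
    {S : Set X} {t : Term D.E X} (h : t.IsLin S) {x : X} (hx : x ∈ S) (y z : V) :
    t.eval op (Function.update v x (y + z)) =
      t.eval op (Function.update v x y) + t.eval op (Function.update v x z) := by
  induction h with
  | var w =>
    obtain rfl : x = w := by simpa using hx
    simp [Term.eval]
  | node e hST hT hS ht hs =>
    rcases hx with hx | hx
    · have := Set.disjoint_left.mp hST hx
      simp [Term.eval, ht hx, eval_update_of_notMem op v hS this]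
    · have := Set.disjoint_right.mp hST hx
      simp [Term.eval, hs hx, eval_update_of_notMem op v hT this]

theorem eval_update_smul [DecidableEq X] (op : D.E →ₗ[K] V →ₗ[K] V →ₗ[K] V) (v : X → V)
    {S : Set X} {t : Term D.E X} (h : t.IsLin S) {x : X} (hx : x ∈ S) (c : K) (y : V) :
    t.eval op (Function.update v x (c • y)) = c • t.eval op (Function.update v x y) := by
  induction h with
  | var w =>
    obtain rfl : x = w := by simpa using hx
    simp [Term.eval]
  | node e hST hT hS ht hs =>
    rcases hx with hx | hx
    · have := Set.disjoint_left.mp hST hx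
      simp [Term.eval, ht hx, eval_update_of_notMem op v hS this]
    · have := Set.disjoint_right.mp hST hx
      simp [Term.eval, hs hx, eval_update_of_notMem op v hT this]

theorem lift_update_add [DecidableEq X] (a : D.Model V) (v : X → V) {p : D.Free X}
    (h : p ∈ lin D (Set.univ : Set X)) (x : X) (y z : V) :
    lift a (Function.update v x (y + z)) p =
      lift a (Function.update v x y) p + lift a (Function.update v x z) p := by
  induction h using Submodule.span_induction with
  | zero => simp
  | add p p' _ _ hp hp' => simp only [map_add, hp, hp']; abel
  | smul c p _ hp => simp only [map_smul, hp, smul_add]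
  | mem p hp =>
    obtain ⟨t, ht, rfl⟩ := hp
    simpa using eval_update_add a.op v ht (Set.mem_univ x) y z

theorem lift_update_smul [DecidableEq X] (a : D.Model V) (v : X → V) {p : D.Free X}
    (h : p ∈ lin D (Set.univ : Set X)) (x : X) (c : K) (y : V) :
    lift a (Function.update v x (c • y)) p = c • lift a (Function.update v x y) p := by
  induction h using Submodule.span_induction with
  | zero => simp
  | add p p' _ _ hp hp' => simp only [map_add, hp, hp', smul_add]
  | smul d p _ hp => simp only [map_smul, hp, smul_comm c d]
  | mem p hp =>
    obtain ⟨t, ht, rfl⟩ := hp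
    simpa using eval_update_smul a.op v ht (Set.mem_univ x) c y

theorem comp_mem_lin {B : Type} (A : B → Type) {p : D.Free B}
    (hp : p ∈ lin D (Set.univ : Set B)) (q : ∀ b, lin D (Set.univ : Set (A b))) :
    lift (model D (Σ b, A b)) (fun b => rename (Sigma.mk b) (q b : D.Free (A b))) p ∈
      lin D (Set.univ : Set (Σ b, A b)) := by
  have h := lift_mem_lin (D := D) (fun b => Set.range (Sigma.mk b : A b → Σ b, A b))
    (fun b b' hb => by
      refine Set.disjoint_left.mpr ?_
      rintro _ ⟨x, rfl⟩ ⟨y, hy⟩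
      exact hb (congrArg Sigma.fst hy).symm)
    (fun b => rename (Sigma.mk b) (q b : D.Free (A b)))
    (fun b => by
      have := rename_mem_lin (D := D) (Sigma.mk b : A b → Σ b, A b) sigma_mk_injective (q b).2
      rwa [Set.image_univ] at this) hp
  have e : (⋃ b ∈ (Set.univ : Set B), Set.range (Sigma.mk b : A b → Σ b, A b)) = Set.univ := by
    ext ⟨b, a⟩; simp
  rwa [e] at h

theorem map_mem_lin {A B : Type} (σ : A ≃ B) {p : D.Free A}
    (hp : p ∈ lin D (Set.univ : Set A)) : rename σ p ∈ lin D (Set.univ : Set B) := by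
  have := rename_mem_lin (D := D) σ σ.injective hp
  rwa [Set.image_univ, σ.range_eq_univ] at this

theorem one_mem_lin : (var () : D.Free Unit) ∈ lin D (Set.univ : Set Unit) := by
  have : (Set.univ : Set Unit) = {()} := by ext; simp
  rw [this]
  exact term_mem_lin (Term.IsLin.var _)

/-- Composition of multilinear operations, by substitution. -/
noncomputable def comp {B : Type} (A : B → Type) :
    lin D (Set.univ : Set B) →ₗ[K]
      MultilinearMap K (fun b => lin D (Set.univ : Set (A b)))
        (lin D (Set.univ : Set (Σ b, A b))) where
  toFun p :=
    { toFun := fun q => ⟨_, comp_mem_lin A p.2 q⟩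
      map_update_add' := fun q b x y => by
        apply Subtype.ext
        have key : ∀ z : lin D (Set.univ : Set (A b)),
            (fun b' => rename (Sigma.mk b') (Function.update q b z b' : D.Free (A b'))) =
              Function.update (fun b' => rename (Sigma.mk b') (q b' : D.Free (A b'))) b
                (rename (Sigma.mk b) (z : D.Free (A b))) := fun z => by
          funext b'
          exact Function.apply_update
            (fun b' (z : lin D (Set.univ : Set (A b'))) =>
              rename (Sigma.mk b') (z : D.Free (A b'))) q b z b'
        simp only [Submodule.coe_add, key, map_add]
        exact lift_update_add _ _ p.2 _ _ _
      map_update_smul' := fun q b c x => by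
        apply Subtype.ext
        have key : ∀ z : lin D (Set.univ : Set (A b)),
            (fun b' => rename (Sigma.mk b') (Function.update q b z b' : D.Free (A b'))) =
              Function.update (fun b' => rename (Sigma.mk b') (q b' : D.Free (A b'))) b
                (rename (Sigma.mk b) (z : D.Free (A b))) := fun z => by
          funext b'
          exact Function.apply_update
            (fun b' (z : lin D (Set.univ : Set (A b'))) =>
              rename (Sigma.mk b') (z : D.Free (A b'))) q b z b'
        simp only [Submodule.coe_smul, key, map_smul]
        exact lift_update_smul _ _ p.2 _ _ _ }
  map_add' p p' := by ext q; simp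
  map_smul' c p := by ext q; simp

theorem coe_comp {B : Type} (A : B → Type) (p : lin D (Set.univ : Set B))
    (q : ∀ b, lin D (Set.univ : Set (A b))) :
    (comp A p q : D.Free (Σ b, A b)) =
      lift (model D (Σ b, A b)) (fun b => rename (Sigma.mk b) (q b : D.Free (A b))) p := rfl

end Free

/-- The operad presented by `D`, that is, the operad whose algebras are the algebras of the type
given by `D`: its operations with inputs `A` are the multilinear iterated operations in the variables
`A`, modulo those vanishing identically in all such algebras. -/
noncomputable def operad (D : QuadData K) : SymOperad K where
  obj A _ := Free.lin D (Set.univ : Set A)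
  grp A _ := inferInstanceAs (AddCommGroup (Free.lin D (Set.univ : Set A)))
  mod A _ := inferInstanceAs (Module K (Free.lin D (Set.univ : Set A)))
  map σ := (Free.rename σ).restrict (fun _ hp => Free.map_mem_lin σ hp)
  one := ⟨Free.var (), Free.one_mem_lin⟩
  comp A _ := Free.comp A
  map_refl p := Subtype.ext (Free.lift_var_self _)
  map_trans σ τ p := Subtype.ext (by exact (Free.rename_rename σ τ p.1).symm)
  one_comp A _ q := Subtype.ext (by
    simp only [Free.coe_comp, Free.lift_var]
    rfl)
  comp_one p := Subtype.ext (by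
    simp only [Free.coe_comp, Free.rename_var]
    rfl)
  comp_assoc B _ A _ p q r := Subtype.ext (by
    simp only [Free.coe_comp, LinearMap.coe_restrict_apply, Free.rename_lift, Free.lift_lift,
      Free.lift_rename, Free.rename_rename]
    rfl)
  comp_map_left σ A _ p q := Subtype.ext (by
    simp only [Free.coe_comp, LinearMap.coe_restrict_apply, Free.rename_lift,
      Free.lift_rename, Free.rename_rename]
    rfl)
  comp_map_right A A' _ _ σ p q := Subtype.ext (by
    simp only [Free.coe_comp, LinearMap.coe_restrict_apply, Free.rename_lift,
      Free.rename_rename]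
    rfl)

/-- The morphism of free algebras induced by a morphism of quadratic data. -/
noncomputable def Free.map {D D' : QuadData K} (f : D ⟶ D') (X : Type) :
    D.Free X →ₗ[K] D'.Free X :=
  Free.lift ((Free.model D' X).restrict f) Free.var

section FreeMap

variable {D D' : QuadData K} (f : D ⟶ D') {X Y : Type}

@[simp] theorem Free.map_var (x : X) : Free.map f X (Free.var x) = Free.var x :=
  Free.lift_var _ _ _

@[simp] theorem Free.map_op (e : D.E) (p q : D.Free X) :
    Free.map f X ((Free.model D X).op e p q) =
      (Free.model D' X).op (f.lin e) (Free.map f X p) (Free.map f X q) :=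
  Free.lift_op _ _ _ _ _

theorem Free.map_lift (g : X → D.Free Y) (p : D.Free X) :
    Free.map f Y (Free.lift (Free.model D Y) g p) =
      Free.lift (Free.model D' Y) (fun x => Free.map f Y (g x)) (Free.map f X p) := by
  have : Free.map f Y ∘ₗ Free.lift (Free.model D Y) g =
      Free.lift (Free.model D' Y) (fun x => Free.map f Y (g x)) ∘ₗ Free.map f X :=
    Free.hom_ext ((Free.model D' Y).op ∘ₗ f.lin) (by simp) (by simp) (by simp)
  exact LinearMap.congr_fun this p

theorem Free.map_rename (g : X → Y) (p : D.Free X) :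
    Free.map f Y (Free.rename g p) = Free.rename g (Free.map f X p) := by
  rw [Free.rename, Free.map_lift]
  simp [Free.rename]

theorem Free.map_mem_lin' {S : Set X} {p : D.Free X} (hp : p ∈ Free.lin D S) :
    Free.map f X p ∈ Free.lin D' S := by
  induction hp using Submodule.span_induction with
  | zero => simp
  | add p p' _ _ hp hp' => rw [map_add]; exact Submodule.add_mem _ hp hp'
  | smul c p _ hp => rw [map_smul]; exact Submodule.smul_mem _ c hp
  | mem p hp =>
    obtain ⟨t, ht, rfl⟩ := hp
    induction ht with
    | var x => exact (Free.map_var f x).symm ▸ Free.term_mem_lin (Term.IsLin.var x)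
    | node e h _ _ ht hs =>
      rw [← Free.op_term, Free.map_op]
      exact Free.op_mem_lin h _ ht hs

end FreeMap

/-- The functor sending binary quadratic data to the presented operad. -/
noncomputable def presented (K : Type u) [Field K] : QuadData K ⥤ SymOperad K where
  obj D := D.operad
  map {D D'} f :=
    { app := fun A _ => (Free.map f A).restrict (fun _ hp => Free.map_mem_lin' f hp)
      app_map := fun σ p => Subtype.ext (Free.map_rename f σ _)
      app_one := Subtype.ext (Free.map_var f ())
      app_comp := fun A _ p q => Subtype.ext (by
        refine (Free.map_lift f _ _).trans ?_
        simp only [Free.map_rename]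
        rfl) }
  map_id D := SymOperad.Hom.ext (by
    funext A _
    ext p : 1
    apply Subtype.ext
    have : Free.map (𝟙 D) A = LinearMap.id :=
      Free.hom_ext (Free.model D A).op (by simp) (by simp) (by simp)
    exact LinearMap.congr_fun this p.1)
  map_comp {D D' D''} f g := SymOperad.Hom.ext (by
    funext A _
    ext p : 1
    apply Subtype.ext
    have : Free.map (f ≫ g) A = Free.map g A ∘ₗ Free.map f A :=
      Free.hom_ext ((Free.model D'' A).op ∘ₗ (f ≫ g).lin) (by simp) (by simp) (by simp)
    exact LinearMap.congr_fun this p.1)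

theorem Term.IsLin.nonempty {E : Type u} {X : Type} {S : Set X} {t : Term E X}
    (h : t.IsLin S) : S.Nonempty := by
  induction h with
  | var x => exact ⟨x, rfl⟩
  | node _ _ _ _ ht _ => exact ht.inl

theorem Term.IsLin.eq_var {E : Type u} {X : Type} {S : Set X} {t : Term E X}
    (h : t.IsLin S) (hS : S.Subsingleton) : ∃ x, t = Term.var x ∧ S = {x} := by
  cases h with
  | var x => exact ⟨x, rfl, rfl⟩
  | node e hd ht hs =>
    obtain ⟨x, hx⟩ := ht.nonempty
    obtain ⟨y, hy⟩ := hs.nonempty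
    have : x = y := hS (Or.inl hx) (Or.inr hy)
    exact absurd (this ▸ hy) (Set.disjoint_left.mp hd hx)

theorem finite_operad_two (D : QuadData K) [Module.Finite K D.E] :
    Module.Finite K (D.operad.obj (Fin 2)) := by
  change Module.Finite K (Free.lin D (Set.univ : Set (Fin 2)))
  let g : D.E →ₗ[K] D.Free (Fin 2) :=
    ((Free.model D (Fin 2)).op.flip (Free.var 0)).flip (Free.var 1)
  have hle : Free.lin D (Set.univ : Set (Fin 2)) ≤ LinearMap.range g := by
    refine Submodule.span_le.mpr ?_
    rintro _ ⟨t, ht, rfl⟩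
    generalize hU : (Set.univ : Set (Fin 2)) = U at ht
    cases ht with
    | var x =>
      exfalso
      have h0 : (0 : Fin 2) ∈ ({x} : Set (Fin 2)) := hU ▸ Set.mem_univ _
      have h1 : (1 : Fin 2) ∈ ({x} : Set (Fin 2)) := hU ▸ Set.mem_univ _
      simp only [Set.mem_singleton_iff] at h0 h1
      exact absurd (h0.trans h1.symm) (by decide)
    | node e hd ht hs =>
      rename_i S T t s
      have sub : ∀ S T : Set (Fin 2), Disjoint S T → T.Nonempty → S.Subsingleton := by
        intro S T hd ⟨z, hz⟩ x hx y hy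
        have h1 : x ≠ z := fun h => Set.disjoint_left.mp hd hx (h ▸ hz)
        have h2 : y ≠ z := fun h => Set.disjoint_left.mp hd hy (h ▸ hz)
        omega
      obtain ⟨x, rfl, rfl⟩ := ht.eq_var (sub _ _ hd hs.nonempty)
      obtain ⟨y, rfl, rfl⟩ := hs.eq_var (sub _ _ hd.symm ht.nonempty)
      have hxy : x ≠ y := by simpa using hd
      rw [← Free.op_term]
      have hc : (x = 0 ∧ y = 1) ∨ (x = 1 ∧ y = 0) := by omega
      rcases hc with ⟨rfl, rfl⟩ | ⟨rfl, rfl⟩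
      · exact ⟨e, rfl⟩
      · exact ⟨D.swap e, (Free.model D (Fin 2)).op_swap e _ _⟩
  have : Module.Finite K (LinearMap.range g) := Module.Finite.range g
  exact Submodule.finiteDimensional_of_le hle

end QuadData

/-- An operad is finitely generated binary quadratic if it has a presentation by finitely many
binary generators and quadratic relations. -/
def IsBinaryQuadratic : ObjectProperty (SymOperad K) := fun P =>
  ∃ D : QuadData K, Module.Finite K D.E ∧ Nonempty (D.operad ≅ P)

/-- The category of finitely generated binary quadratic symmetric operads over `K`. -/
abbrev BQOp (K : Type u) [Field K] := (IsBinaryQuadratic (K := K)).FullSubcategory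

theorem IsBinaryQuadratic.finite_two {P : SymOperad K} (h : IsBinaryQuadratic P) :
    Module.Finite K (P.obj (Fin 2)) := by
  obtain ⟨D, hD, ⟨i⟩⟩ := h
  have := D.finite_operad_two
  refine Module.Finite.of_surjective (i.hom.app (Fin 2)) fun p => ⟨i.inv.app (Fin 2) p, ?_⟩
  rw [← SymOperad.comp_app, i.inv_hom_id, SymOperad.id_app]

/-- A functorial construction of finitely generated quadratic data gives a functor with values in
binary quadratic operads. -/
noncomputable def presentedFunctor (F : BQOp K ⥤ QuadData K)
    (hF : ∀ P, Module.Finite K (F.obj P).E) : BQOp K ⥤ BQOp K :=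
  ObjectProperty.lift _ (F ⋙ QuadData.presented K) fun P => ⟨F.obj P, hF P, ⟨Iso.refl _⟩⟩

/-! ### The Manin white product -/

/-- The comparison map from the arity `3` part of the free operad on `P(2) ⊗ Q(2)` to
`P(3) ⊗ Q(3)`, sending `(p ⊗ q) ∘_i (p' ⊗ q')` to `(p ∘_i p') ⊗ (q ∘_i q')`. -/
noncomputable def whiteMap (P Q : SymOperad K) :
    Tern K (P.obj (Fin 2) ⊗[K] Q.obj (Fin 2)) →ₗ[K] P.obj (Fin 3) ⊗[K] Q.obj (Fin 3) :=
  ∑ i, TensorProduct.map (TensorProduct.lift (P.circ i)) (TensorProduct.lift (Q.circ i)) ∘ₗ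
    (TensorProduct.tensorTensorTensorComm K _ _ _ _).toLinearMap ∘ₗ LinearMap.proj i

/-- The quadratic data of the white product: the generators are `P(2) ⊗ Q(2)`, and the relations are
the ternary operations in them which vanish in the Hadamard product of `P` and `Q`. -/
noncomputable abbrev whiteData (P Q : SymOperad K) : QuadData K where
  E := P.obj (Fin 2) ⊗[K] Q.obj (Fin 2)
  swap := TensorProduct.map P.swap Q.swap
  swap_swap e := by
    have : TensorProduct.map P.swap Q.swap ∘ₗ TensorProduct.map P.swap Q.swap =
        LinearMap.id := TensorProduct.ext' fun p q => by simp [SymOperad.swap_swap]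
    exact LinearMap.congr_fun this e
  rel := LinearMap.ker (whiteMap P Q)

theorem whiteMap_natural (P : SymOperad K) {Q Q' : SymOperad K} (f : Q ⟶ Q')
    (r : Tern K (P.obj (Fin 2) ⊗[K] Q.obj (Fin 2))) :
    whiteMap P Q' (ternMap (TensorProduct.map LinearMap.id (f.app (Fin 2))) r) =
      TensorProduct.map LinearMap.id (f.app (Fin 3)) (whiteMap P Q r) := by
  simp only [whiteMap, ternMap, LinearMap.sum_apply, map_sum, LinearMap.comp_apply,
    LinearMap.proj_apply, LinearMap.pi_apply]
  refine Finset.sum_congr rfl fun i _ => ?_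
  generalize r i = s
  induction s using TensorProduct.induction_on with
  | zero => simp
  | add s s' hs hs' => simp only [map_add, hs, hs']
  | tmul a b =>
    induction a using TensorProduct.induction_on with
    | zero => simp
    | add a a' ha ha' => simp only [TensorProduct.add_tmul, map_add, ha, ha']
    | tmul p q =>
      induction b using TensorProduct.induction_on with
      | zero => simp
      | add b b' hb hb' => simp only [TensorProduct.tmul_add, map_add, hb, hb']
      | tmul p' q' => simp [SymOperad.Hom.app_circ]

/-- The Manin white product `Q ↦ P ∘ Q`, on quadratic data. -/
noncomputable def whiteDataFunctor (P : BQOp K) : BQOp K ⥤ QuadData K where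
  obj Q := whiteData P.obj Q.obj
  map {Q Q'} f :=
    { lin := TensorProduct.map LinearMap.id (SymOperad.Hom.app f.hom (Fin 2))
      lin_swap := fun e => by
        have : TensorProduct.map LinearMap.id (SymOperad.Hom.app f.hom (Fin 2)) ∘ₗ
              TensorProduct.map P.obj.swap Q.obj.swap =
            TensorProduct.map P.obj.swap Q'.obj.swap ∘ₗ
              TensorProduct.map LinearMap.id (SymOperad.Hom.app f.hom (Fin 2)) :=
          TensorProduct.ext' fun p q => by simp [SymOperad.Hom.app_swap]
        exact LinearMap.congr_fun this e
      lin_rel := fun r hr => by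
        have hr : whiteMap P.obj Q.obj r = 0 := hr
        refine (whiteMap_natural P.obj f.hom r).trans ?_
        rw [hr, map_zero] }
  map_id Q := QuadData.Hom.ext (TensorProduct.ext' fun _ _ => rfl)
  map_comp f g := QuadData.Hom.ext (TensorProduct.ext' fun _ _ => rfl)

/-- The functor `P ∘ -` of Manin white product with `P`. -/
noncomputable def whiteProduct (P : BQOp K) : BQOp K ⥤ BQOp K :=
  presentedFunctor (whiteDataFunctor P) fun Q => by
    have := P.property.finite_two
    have := Q.property.finite_two
    exact inferInstanceAs (Module.Finite K (P.obj.obj (Fin 2) ⊗[K] Q.obj.obj (Fin 2)))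

/-! ### The operad of Lie algebras -/

/-- One antisymmetric generator `[-, -]`, with the Jacobi relation
`[[x_0, x_1], x_2] + [[x_1, x_2], x_0] + [[x_2, x_0], x_1] = 0`. -/
noncomputable abbrev lieData (K : Type u) [Field K] : QuadData K where
  E := K
  swap := -LinearMap.id
  swap_swap e := by simp
  rel := Submodule.span K {fun _ => (1 : K) ⊗ₜ[K] (1 : K)}

/-- The operad of Lie algebras. -/
noncomputable def lieOperad (K : Type u) [Field K] : BQOp K :=
  ⟨(lieData K).operad, lieData K, inferInstanceAs (Module.Finite K K), ⟨Iso.refl _⟩⟩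

/-! ### Cochains on the interval and the cup brackets -/

/-- Non-degenerate cochains on the `1`-simplex with coefficients in `V`: the first component is a
`0`-cochain, that is, a function on the vertices `0` (left) and `1` (right), and the second component
is the value of a `1`-cochain on the edge. -/
abbrev Cochain (V : Type u) : Type u := (Fin 2 → V) × V

namespace Cochain

variable {V : Type u} [AddCommGroup V] [Module K V]

/-- The cochains of degree `n`. -/
def deg (K : Type u) [Field K] (V : Type u) [AddCommGroup V] [Module K V] :
    ℕ → Submodule K (Cochain V)
  | 0 => LinearMap.ker (LinearMap.snd K (Fin 2 → V) V)
  | 1 => LinearMap.ker (LinearMap.fst K (Fin 2 → V) V)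
  | _ + 2 => ⊥

/-- The differential. -/
def d : Cochain V →ₗ[K] Cochain V where
  toFun α := (0, α.1 1 - α.1 0)
  map_add' α β := by ext <;> simp; abel
  map_smul' c α := by ext <;> simp [smul_sub]

/-- The relative cochains `C^*(Δ_1, X; V)`, where `X` is a set of vertices. -/
def rel (K : Type u) [Field K] (V : Type u) [AddCommGroup V] [Module K V] (X : Set (Fin 2)) :
    Submodule K (Cochain V) where
  carrier := {α | ∀ v ∈ X, α.1 v = 0}
  zero_mem' := by intro v _; rfl
  add_mem' := by intro α β hα hβ v hv; simp [hα v hv, hβ v hv]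
  smul_mem' := by intro c α hα v hv; simp [hα v hv]

/-- The cup product of cochains, with respect to a bilinear product on the coefficients. -/
def cup (m : V →ₗ[K] V →ₗ[K] V) : Cochain V →ₗ[K] Cochain V →ₗ[K] Cochain V :=
  LinearMap.mk₂ K
    (fun α β => (fun v => m (α.1 v) (β.1 v), m (α.1 0) β.2 + m α.2 (β.1 1)))
    (fun α α' β => by ext <;> simp; abel)
    (fun c α β => by ext <;> simp)
    (fun α β β' => by ext <;> simp; abel)
    (fun c α β => by ext <;> simp)

/-- The cup bracket `(∪ - ∪^op) ⊗ m` with respect to a bilinear product `m` on the coefficients,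
where `∪^op ⊗ m` is the opposite of the operation `∪ ⊗ m^op`. (The Koszul sign in the opposite of an
operation on cochains concerns only pairs of `1`-cochains, whose cup products vanish.) -/
def cupBracket (m : V →ₗ[K] V →ₗ[K] V) : Cochain V →ₗ[K] Cochain V →ₗ[K] Cochain V :=
  cup m - (cup m.flip).flip

/-- The Koszul sign of the permutation `(x_0, x_1, x_2) ↦ (x_i, x_{i+1}, x_{i+2})` of elements of
degrees `n 0, n 1, n 2`. -/
def koszulSign (K : Type u) [Field K] (n : Fin 3 → ℕ) : Fin 3 → K
  | 0 => 1
  | 1 => (-1) ^ (n 0 * (n 1 + n 2))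
  | 2 => (-1) ^ (n 2 * (n 0 + n 1))

/-- The value of a ternary operation at homogeneous cochains `x 0, x 1, x 2` of degrees
`n 0, n 1, n 2`. -/
noncomputable def gradedEval {E : Type u} [AddCommGroup E] [Module K E]
    (op : E →ₗ[K] Cochain V →ₗ[K] Cochain V →ₗ[K] Cochain V) (n : Fin 3 → ℕ)
    (x : Fin 3 → Cochain V) : Tern K E →ₗ[K] Cochain V :=
  ∑ i, koszulSign K n i • (ternTerm op x i ∘ₗ LinearMap.proj i)

/-- The binary operations `op e`, for `e : E`, make the complex of cochains a local dg algebra over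
the operad generated by `E` (where `sw` sends a generator to the opposite one) with relations `R`:
they are homogeneous of degree zero, compatible with opposites in the graded sense, satisfy the
Leibniz rule and the relations, and the relative cochains of any closed subset form an ideal. -/
structure IsLocalDG {E : Type u} [AddCommGroup E] [Module K E] (sw : E →ₗ[K] E)
    (R : Submodule K (Tern K E))
    (op : E →ₗ[K] Cochain V →ₗ[K] Cochain V →ₗ[K] Cochain V) : Prop where
  degree : ∀ e i j, ∀ α ∈ deg K V i, ∀ β ∈ deg K V j, op e α β ∈ deg K V (i + j)
  symm : ∀ e i j, ∀ α ∈ deg K V i, ∀ β ∈ deg K V j,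
    op (sw e) α β = (-1 : K) ^ (i * j) • op e β α
  leibniz : ∀ e i, ∀ α ∈ deg K V i, ∀ β,
    d (K := K) (op e α β) = op e (d (K := K) α) β + (-1 : K) ^ i • op e α (d (K := K) β)
  relations : ∀ r ∈ R, ∀ (n : Fin 3 → ℕ) (x : Fin 3 → Cochain V),
    (∀ i, x i ∈ deg K V (n i)) → gradedEval op n x r = 0
  local_left : ∀ e (X : Set (Fin 2)), ∀ α ∈ rel K V X, ∀ β, op e α β ∈ rel K V X
  local_right : ∀ e (X : Set (Fin 2)), ∀ α, ∀ β ∈ rel K V X, op e α β ∈ rel K V X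

end Cochain

/-- The cup brackets on the cochains with coefficients in a `P`-algebra, indexed by `P(2)`. -/
def cupBrackets {P : SymOperad K} {V : Type u} [AddCommGroup V] [Module K V] (a : P.Alg V) :
    P.obj (Fin 2) →ₗ[K] Cochain V →ₗ[K] Cochain V →ₗ[K] Cochain V where
  toFun p := Cochain.cupBracket (a.bin p)
  map_add' p q := by
    ext <;> simp [Cochain.cupBracket, Cochain.cup] <;> abel
  map_smul' c p := by
    ext <;> simp [Cochain.cupBracket, Cochain.cup, smul_sub]

/-- The largest space of relations making the cochains with coefficients in any `P`-algebra, with the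
cup brackets, a local dg algebra. The generators correspond to the binary operations of `P`; as the
bracket `∪ - ∪^op` is antisymmetric, the opposite of the cup bracket of `p` is minus the cup bracket of
`p^op`, so that symmetric operations give antisymmetric cup brackets and conversely. -/
def lieCircRel (P : SymOperad K) : Submodule K (Tern K (P.obj (Fin 2))) :=
  sSup {R | ∀ (V : Type u) [AddCommGroup V] [Module K V] (a : P.Alg V),
    Cochain.IsLocalDG (-P.swap) R (cupBrackets a)}

theorem SymOperad.Alg.bin_swap {P : SymOperad K} {V : Type u} [AddCommGroup V] [Module K V]
    (a : P.Alg V) (p : P.obj (Fin 2)) (x y : V) : a.bin (P.swap p) x y = a.bin p y x := by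
  change a.act (P.map _ p) ![x, y] = a.act p ![y, x]
  rw [a.act_map]
  congr 1
  funext i
  fin_cases i <;> rfl

theorem cupBrackets_apply {P : SymOperad K} {V : Type u} [AddCommGroup V] [Module K V]
    (a : P.Alg V) (p : P.obj (Fin 2)) (α β : Cochain V) :
    cupBrackets a p α β =
      (0, a.bin p (α.1 0) β.2 + a.bin p α.2 (β.1 1) -
        (a.bin p α.2 (β.1 0) + a.bin p (α.1 1) β.2)) := by
  ext v
  · simp [cupBrackets, Cochain.cupBracket, Cochain.cup]
  · simp [cupBrackets, Cochain.cupBracket, Cochain.cup]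

theorem Cochain.mem_deg_zero {V : Type u} [AddCommGroup V] [Module K V] {α : Cochain V} :
    α ∈ deg K V 0 ↔ α.2 = 0 := Iff.rfl

theorem Cochain.mem_deg_one {V : Type u} [AddCommGroup V] [Module K V] {α : Cochain V} :
    α ∈ deg K V 1 ↔ α.1 = 0 := Iff.rfl

theorem Cochain.mem_deg_add_two {V : Type u} [AddCommGroup V] [Module K V] {α : Cochain V}
    {n : ℕ} : α ∈ deg K V (n + 2) ↔ α = 0 := Iff.rfl

/-- The cup brackets always satisfy all the conditions of a local dg algebra, except possibly for the
relations. -/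
theorem isLocalDG_cupBrackets_iff {P : SymOperad K} {V : Type u} [AddCommGroup V] [Module K V]
    (a : P.Alg V) (R : Submodule K (Tern K (P.obj (Fin 2)))) :
    Cochain.IsLocalDG (-P.swap) R (cupBrackets a) ↔
      ∀ r ∈ R, ∀ (n : Fin 3 → ℕ) (x : Fin 3 → Cochain V),
        (∀ i, x i ∈ Cochain.deg K V (n i)) → Cochain.gradedEval (cupBrackets a) n x r = 0 := by
  refine ⟨fun h => h.relations, fun h => ⟨?_, ?_, ?_, h, ?_, ?_⟩⟩
  · intro e i j α hα β hβ
    match i, j, hα, hβ with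
    | 0, 0, hα, hβ =>
      rw [Cochain.mem_deg_zero] at hα hβ
      change (cupBrackets a e α β).2 = 0
      simp [cupBrackets_apply, hα, hβ]
    | 0, 1, hα, hβ =>
      change (cupBrackets a e α β).1 = 0
      simp [cupBrackets_apply]
    | 1, 0, hα, hβ =>
      change (cupBrackets a e α β).1 = 0
      simp [cupBrackets_apply]
    | 1, 1, hα, hβ =>
      rw [Cochain.mem_deg_one] at hα hβ
      change cupBrackets a e α β = 0
      simp [cupBrackets_apply, hα, hβ]
    | i + 2, j, hα, hβ =>
      rw [Cochain.mem_deg_add_two] at hα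
      rw [hα, map_zero]
      exact Submodule.zero_mem _
    | i, j + 2, hα, hβ =>
      rw [Cochain.mem_deg_add_two] at hβ
      rw [hβ, map_zero]
      exact Submodule.zero_mem _
  · intro e i j α hα β hβ
    have key : cupBrackets a ((-P.swap) e) α β = cupBrackets a e β α := by
      simp only [cupBrackets_apply, LinearMap.neg_apply, map_neg, a.bin_swap]
      rw [Prod.neg_mk, neg_zero]
      congr 1
      abel
    rw [key]
    match i, j, hα, hβ with
    | 0, j, hα, hβ => simp
    | i, 0, hα, hβ => simp
    | 1, 1, hα, hβ =>
      rw [Cochain.mem_deg_one] at hα hβ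
      simp [cupBrackets_apply, hα, hβ]
    | i + 2, j, hα, hβ =>
      rw [Cochain.mem_deg_add_two] at hα
      rw [hα, map_zero, smul_zero]
    | i, j + 2, hα, hβ =>
      rw [Cochain.mem_deg_add_two] at hβ
      simp [hβ]
  · intro e i α hα β
    match i, hα with
    | 0, hα =>
      rw [Cochain.mem_deg_zero] at hα
      ext
      · simp [cupBrackets_apply, Cochain.d]
      · simp [cupBrackets_apply, Cochain.d, hα]
        abel
    | 1, hα =>
      rw [Cochain.mem_deg_one] at hα
      ext <;> simp [cupBrackets_apply, Cochain.d, hα]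
    | i + 2, hα =>
      rw [Cochain.mem_deg_add_two] at hα
      simp [hα]
  · intro e X α _ β v _
    simp [cupBrackets_apply]
  · intro e X α β _ v _
    simp [cupBrackets_apply]

theorem mem_lieCircRel_iff {P : SymOperad K} (r : Tern K (P.obj (Fin 2))) :
    r ∈ lieCircRel P ↔
      ∀ (V : Type u) [AddCommGroup V] [Module K V] (a : P.Alg V) (n : Fin 3 → ℕ)
        (x : Fin 3 → Cochain V), (∀ i, x i ∈ Cochain.deg K V (n i)) →
          Cochain.gradedEval (cupBrackets a) n x r = 0 := by
  constructor
  · intro hr V _ _ a n x hx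
    have hle : lieCircRel P ≤ LinearMap.ker (Cochain.gradedEval (cupBrackets a) n x) := by
      refine sSup_le fun R hR r hr => ?_
      exact (isLocalDG_cupBrackets_iff a R).mp (hR V a) r hr n x hx
    exact hle hr
  · intro h
    have hmem : Submodule.span K {r} ≤ lieCircRel P := by
      refine le_sSup fun V _ _ a => (isLocalDG_cupBrackets_iff a _).mpr fun s hs n x hx => ?_
      obtain ⟨c, rfl⟩ := Submodule.mem_span_singleton.mp hs
      rw [map_smul, h V a n x hx, smul_zero]
    exact hmem (Submodule.mem_span_singleton_self r)

/-- The cochains with coefficients in any `P`-algebra are a local dg algebra for the relations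
`lieCircRel P`, and any other such space of relations is contained in it. -/
theorem lieCircRel_isGreatest (P : SymOperad K) :
    IsGreatest {R | ∀ (V : Type u) [AddCommGroup V] [Module K V] (a : P.Alg V),
      Cochain.IsLocalDG (-P.swap) R (cupBrackets a)} (lieCircRel P) :=
  ⟨fun V _ _ a => (isLocalDG_cupBrackets_iff a _).mpr fun r hr =>
    (mem_lieCircRel_iff r).mp hr V a, fun _ hR => le_sSup hR⟩

theorem gradedEval_ternMap {E E' V : Type u} [AddCommGroup E] [Module K E] [AddCommGroup E']
    [Module K E'] [AddCommGroup V] [Module K V] (f : E →ₗ[K] E')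
    (op : E →ₗ[K] Cochain V →ₗ[K] Cochain V →ₗ[K] Cochain V)
    (op' : E' →ₗ[K] Cochain V →ₗ[K] Cochain V →ₗ[K] Cochain V)
    (h : ∀ e α β, op e α β = op' (f e) α β) (n : Fin 3 → ℕ) (x : Fin 3 → Cochain V)
    (r : Tern K E) :
    Cochain.gradedEval op' n x (ternMap f r) = Cochain.gradedEval op n x r := by
  have key := fun i => ternTerm_map f LinearMap.id op op' h x i (r i)
  simp only [LinearMap.id_apply] at key
  simp [Cochain.gradedEval, ternMap, key]

theorem ternMap_mem_lieCircRel {P Q : SymOperad K} (f : P ⟶ Q) {r : Tern K (P.obj (Fin 2))}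
    (hr : r ∈ lieCircRel P) : ternMap (f.app (Fin 2)) r ∈ lieCircRel Q := by
  rw [mem_lieCircRel_iff] at hr ⊢
  intro V _ _ a n x hx
  rw [gradedEval_ternMap (f.app (Fin 2)) (cupBrackets (a.restrict f)) (cupBrackets a)
    (fun _ _ _ => rfl)]
  exact hr V (a.restrict f) n x hx

/-- The quadratic data of `Lie_∘(P)`: it is generated by the cup brackets, with the largest space of
relations. -/
abbrev lieCircData (P : SymOperad K) : QuadData K where
  E := P.obj (Fin 2)
  swap := -P.swap
  swap_swap e := by simp [P.swap_swap]
  rel := lieCircRel P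

/-- The functor `Lie_∘(-)`, on quadratic data. -/
def lieCircDataFunctor (K : Type u) [Field K] : BQOp K ⥤ QuadData K where
  obj P := lieCircData P.obj
  map f :=
    { lin := SymOperad.Hom.app f.hom (Fin 2)
      lin_swap := fun e => (map_neg _ _).trans (congrArg _ (SymOperad.Hom.app_swap f.hom e))
      lin_rel := fun _ hr => ternMap_mem_lieCircRel f.hom hr }
  map_id _ := rfl
  map_comp _ _ := rfl

/-- The functor `Lie_∘(-)`. -/
noncomputable def lieCirc (K : Type u) [Field K] : BQOp K ⥤ BQOp K :=
  presentedFunctor (lieCircDataFunctor K) fun P => P.property.finite_two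

end Manin

namespace Manin

/-! ### Algebras over a presented operad, and how they separate operations -/

namespace SymOperad

variable {K : Type u} [Field K]

/-! Both sides have the same generators, and their relations reduce to one and the same condition in
`P(3)`.

Cochain side. Write `e α` for the edge value of a cochain and `δ α = α(1) - α(0)`. The cup bracket
of `m` has no vertex part, and its edge value is `m(e α, δ β) - m(δ α, e β)`. A bracket therefore
has `δ = 0`, and the iterated bracket `μ(ν(x_i, x_{i+1}), x_{i+2})` has edge value `μ(ν(e x_i, δ
x_{i+1}), δ x_{i+2}) - μ(ν(δ x_i, e x_{i+1}), δ x_{i+2})`. For `r = (r_0, r_1, r_2)` let `t_i` in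
`P(3)` be the composite of `r_i`. Only triples with a single 1-cochain and two 0-cochains can give a
nonzero value; all Koszul signs are then 1, and a 1-cochain in position `i + 1` leaves `t_{i+1} -
t_i`. Algebras separate the operations of a binary quadratic operad (`IsBinaryQuadratic.ext`), so
`r` is a relation exactly when `t_0 = t_1 = t_2` (`mem_lieCircRel_iff_circLift`).

White product side. `Lie(2)` is the line spanned by the bracket, so `p ↦ [-, -] ⊗ p` is a bijection
on generators. It sends `r` to an element whose image in `Lie(3) ⊗ P(3)` is `∑ b_i ⊗ t_i`, where the
`b_i` are the three iterated brackets. The Jacobi identity is the only linear relation between them,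
so this sum vanishes exactly when `t_0 = t_1 = t_2` (`sum_lieBracket₃_tmul_eq_zero_iff`).

The bijection does not depend on `P`, hence is natural. Independence in `Lie` is tested on
commutators of matrix units, with values 0 and ±1, so no assumption on the characteristic is needed.
-/

theorem Alg.act_circ {P : SymOperad K} {V : Type u} [AddCommGroup V] [Module K V] (a : P.Alg V)
    (i : Fin 3) (μ ν : P.obj (Fin 2)) (v : Fin 3 → V) :
    a.act (P.circ i μ ν) v = a.bin μ (a.bin ν (v i) (v (i + 1))) (v (i + 2)) := by
  simp only [circ, LinearMap.mk₂_apply]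
  rw [a.act_map, a.act_comp]
  change a.act μ _ = a.act μ ![a.act ν ![v i, v (i + 1)], v (i + 2)]
  congr 1
  funext b
  match b with
  | 0 =>
    change a.act ν _ = a.act ν _
    refine congrArg _ (funext fun c : Fin 2 => ?_)
    fin_cases c
    · change v (i + 0) = v i
      rw [add_zero]
    · rfl
  | 1 => exact a.act_one _

/-- The linear extension of `μ ⊗ ν ↦ μ(ν(x_i, x_{i+1}), x_{i+2})`. -/
noncomputable abbrev circLift (P : SymOperad K) (i : Fin 3) :
    P.obj (Fin 2) ⊗[K] P.obj (Fin 2) →ₗ[K] P.obj (Fin 3) :=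
  TensorProduct.lift (P.circ i)

theorem Alg.act_circLift {P : SymOperad K} {V : Type u} [AddCommGroup V] [Module K V]
    (a : P.Alg V) (i : Fin 3) (s : P.obj (Fin 2) ⊗[K] P.obj (Fin 2)) (v : Fin 3 → V) :
    a.act (P.circLift i s) v = ternTerm a.bin v i s := by
  induction s using TensorProduct.induction_on with
  | zero => simp
  | add s t hs ht => simp only [map_add, add_apply, hs, ht]
  | tmul μ ν => simp [ternTerm, a.act_circ]

end SymOperad

namespace QuadData

variable {K : Type u} [Field K] {D : QuadData K} {V : Type u} [AddCommGroup V] [Module K V]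

/-- Models of quadratic data are algebras over the presented operad. -/
noncomputable def Model.toAlg (a : D.Model V) : D.operad.Alg V where
  act {A} _ :=
    { toFun := fun p =>
        { toFun := fun v => Free.lift a v p.1
          map_update_add' := fun v i x y => Free.lift_update_add a v p.2 i x y
          map_update_smul' := fun v i c x => Free.lift_update_smul a v p.2 i c x }
      map_add' := fun p q => MultilinearMap.ext fun v => map_add (Free.lift a v) p.1 q.1
      map_smul' := fun c p => MultilinearMap.ext fun v => map_smul (Free.lift a v) c p.1 }
  act_one v := Free.lift_var a v ()
  act_map σ p v := Free.lift_rename a v σ p.1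
  act_comp A _ p q v := by
    refine (Free.lift_lift a v _ _).trans ?_
    simp only [Free.lift_rename]
    rfl

/-- Operations of the presented operad are formal operations modulo those vanishing in every model,
and `Model.toAlg` turns every model into an algebra. -/
theorem operad_ext {A : Type} [Finite A] {p q : D.operad.obj A}
    (h : ∀ (V : Type u) [AddCommGroup V] [Module K V] (a : D.operad.Alg V) (v : A → V),
      a.act p v = a.act q v) : p = q :=
  Subtype.ext (Free.ext fun V _ _ a v => h V a.toAlg v)

variable (D) in
theorem binOp_mem_lin (e : D.E) :
    (Free.model D (Fin 2)).op e (Free.var 0) (Free.var 1) ∈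
      Free.lin D (Set.univ : Set (Fin 2)) := by
  have h : (Set.univ : Set (Fin 2)) = {0} ∪ {1} := by
    ext i
    fin_cases i <;> simp
  rw [h]
  exact Free.op_mem_lin (by simp) e (Free.term_mem_lin (.var 0)) (Free.term_mem_lin (.var 1))

variable (D) in
/-- The generators, as binary operations of the presented operad. -/
noncomputable def gen : D.E →ₗ[K] D.operad.obj (Fin 2) where
  toFun e := ⟨_, D.binOp_mem_lin e⟩
  map_add' e f := Subtype.ext (by
    change (Free.model D (Fin 2)).op (e + f) _ _ = _ + _
    rw [map_add]; rfl)
  map_smul' c e := Subtype.ext (by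
    change (Free.model D (Fin 2)).op (c • e) _ _ = c • _
    rw [map_smul]; rfl)

theorem Model.bin_gen (a : D.Model V) (e : D.E) (x y : V) :
    a.toAlg.bin (D.gen e) x y = a.op e x y := by
  change Free.lift a ![x, y] ((Free.model D (Fin 2)).op e (Free.var 0) (Free.var 1)) = _
  simp

theorem swap_gen (e : D.E) : D.operad.swap (D.gen e) = D.gen (D.swap e) := by
  refine Subtype.ext (Free.ext fun V _ _ a v => ?_)
  refine (Free.lift_rename a v (Equiv.swap 0 1) (D.gen e).1).trans ?_
  change Free.lift a _ ((Free.model D (Fin 2)).op e (Free.var 0) (Free.var 1)) =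
    Free.lift a v ((Free.model D (Fin 2)).op (D.swap e) (Free.var 0) (Free.var 1))
  simp [a.op_swap]

variable (D) in
-- A formal operation using each of two variables once is a single node on two variables. If they
-- occur in the wrong order, the opposite generator gives the same operation.
theorem gen_surjective : Function.Surjective D.gen := by
  suffices h : Free.lin D (Set.univ : Set (Fin 2)) ≤
      Submodule.map (Free.lin D (Set.univ : Set (Fin 2))).subtype (LinearMap.range D.gen) by
    intro p
    obtain ⟨q, ⟨e, rfl⟩, hq⟩ := h p.2
    exact ⟨e, Subtype.ext hq⟩
  refine Submodule.span_le.mpr ?_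
  rintro _ ⟨t, ht, rfl⟩
  suffices h : ∃ e, (Free.model D (Fin 2)).op e (Free.var 0) (Free.var 1) = Free.term t by
    obtain ⟨e, he⟩ := h
    exact ⟨D.gen e, ⟨e, rfl⟩, he⟩
  generalize hU : (Set.univ : Set (Fin 2)) = U at ht
  cases ht with
  | var x =>
    exfalso
    have h0 : (0 : Fin 2) ∈ ({x} : Set (Fin 2)) := hU ▸ Set.mem_univ _
    have h1 : (1 : Fin 2) ∈ ({x} : Set (Fin 2)) := hU ▸ Set.mem_univ _
    simp only [Set.mem_singleton_iff] at h0 h1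
    exact absurd (h0.trans h1.symm) (by decide)
  | node e hd ht hs =>
    have sub : ∀ S T : Set (Fin 2), Disjoint S T → T.Nonempty → S.Subsingleton := by
      intro S T hd ⟨z, hz⟩ x hx y hy
      have h1 : x ≠ z := fun h => Set.disjoint_left.mp hd hx (h ▸ hz)
      have h2 : y ≠ z := fun h => Set.disjoint_left.mp hd hy (h ▸ hz)
      omega
    obtain ⟨x, rfl, rfl⟩ := ht.eq_var (sub _ _ hd hs.nonempty)
    obtain ⟨y, rfl, rfl⟩ := hs.eq_var (sub _ _ hd.symm ht.nonempty)
    have hxy : x ≠ y := by simpa using hd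
    rw [← Free.op_term]
    have hc : (x = 0 ∧ y = 1) ∨ (x = 1 ∧ y = 0) := by omega
    rcases hc with ⟨rfl, rfl⟩ | ⟨rfl, rfl⟩
    · exact ⟨e, rfl⟩
    · exact ⟨D.swap e, (Free.model D (Fin 2)).op_swap e _ _⟩

/-- The relations hold in the presented operad. -/
theorem sum_circLift_gen {r : Tern K D.E} (hr : r ∈ D.rel) :
    ∑ i, D.operad.circLift i (TensorProduct.map D.gen D.gen (r i)) = 0 := by
  refine Subtype.ext (Free.ext fun V _ _ a v => ?_)
  -- The equality is tested in each model, where the sum of composites becomes the value of `r`,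
  -- which is zero.
  have h := ternEval_map D.gen LinearMap.id a.op a.toAlg.bin
    (fun e x y => (a.bin_gen e x y).symm) v r
  simp only [LinearMap.id_apply, a.op_rel r hr v] at h
  change a.toAlg.act _ v = a.toAlg.act 0 v
  rw [map_sum, map_zero, sum_apply, zero_apply, h]
  simp [a.toAlg.act_circLift, ternEval, ternMap]

end QuadData

variable {K : Type u} [Field K]

/-- This converts identities valid in all `P`-algebras into equalities in `P`, by transporting
`QuadData.operad_ext` along a presentation. -/
theorem IsBinaryQuadratic.ext {P : SymOperad K} (hP : IsBinaryQuadratic P) {A : Type} [Finite A]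
    {p q : P.obj A}
    (h : ∀ (V : Type u) [AddCommGroup V] [Module K V] (a : P.Alg V) (v : A → V),
      a.act p v = a.act q v) : p = q := by
  obtain ⟨D, -, ⟨i⟩⟩ := hP
  have key : i.inv.app A p = i.inv.app A q :=
    QuadData.operad_ext fun V _ _ a v => h V (a.restrict i.inv) v
  have := congrArg (i.hom.app A) key
  rwa [← SymOperad.comp_app, ← SymOperad.comp_app, i.inv_hom_id] at this

/-! ### The relations of `Lie_∘(P)` -/

section Relations

variable {P : SymOperad K} {V : Type u} [AddCommGroup V] [Module K V]

/-- The edge value can enter only through one of the two inputs of the inner bracket; every other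
input contributes its difference of vertex values. -/
theorem ternTerm_cupBrackets (a : P.Alg V) (x : Fin 3 → Cochain V) (i : Fin 3)
    (s : P.obj (Fin 2) ⊗[K] P.obj (Fin 2)) :
    ternTerm (cupBrackets a) x i s =
      (0, a.act (P.circLift i s)
            (Function.update (fun j => (x j).1 1 - (x j).1 0) i (x i).2) -
          a.act (P.circLift i s)
            (Function.update (fun j => (x j).1 1 - (x j).1 0) (i + 1) (x (i + 1)).2)) := by
  have h01 : i + 1 ≠ i := by revert i; decide
  have h02 : i + 2 ≠ i := by revert i; decide
  have h12 : i + 2 ≠ i + 1 := by revert i; decide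
  induction s using TensorProduct.induction_on with
  | zero =>
    simp
    rfl
  | add s t hs ht =>
    simp only [map_add, hs, ht, add_apply, Prod.mk_add_mk, add_zero]
    congr 1
    abel
  | tmul μ ν =>
    simp only [ternTerm, TensorProduct.lift.tmul, LinearMap.mk₂_apply, a.act_circ,
      cupBrackets_apply, Function.update_self, Function.update_of_ne h01,
      Function.update_of_ne h01.symm, Function.update_of_ne h02, Function.update_of_ne h12]
    congr 1
    -- The inner bracket has zero vertex part, which kills two of the four terms of the outer
    -- bracket.
    simp only [Pi.zero_apply, map_zero, map_add, map_sub, LinearMap.add_apply, LinearMap.sub_apply,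
      LinearMap.zero_apply]
    abel

theorem gradedEval_cupBrackets (a : P.Alg V) (n : Fin 3 → ℕ) (x : Fin 3 → Cochain V)
    (r : Tern K (P.obj (Fin 2))) :
    Cochain.gradedEval (cupBrackets a) n x r =
      (0, ∑ i, Cochain.koszulSign K n i •
        (a.act (P.circLift i (r i))
            (Function.update (fun j => (x j).1 1 - (x j).1 0) i (x i).2) -
          a.act (P.circLift i (r i))
            (Function.update (fun j => (x j).1 1 - (x j).1 0) (i + 1) (x (i + 1)).2))) := by
  simp only [Cochain.gradedEval, LinearMap.sum_apply, LinearMap.smul_apply, LinearMap.comp_apply,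
    LinearMap.proj_apply, ternTerm_cupBrackets]
  ext <;> simp [Fin.sum_univ_three]

/-- A cochain of degree 0 has no edge value, and one of positive degree has no vertex values. Either
way, one input is zero. -/
theorem act_update_eq_zero (a : P.Alg V) {n : Fin 3 → ℕ} {x : Fin 3 → Cochain V}
    (hx : ∀ i, x i ∈ Cochain.deg K V (n i)) (t : P.obj (Fin 3)) (j : Fin 3)
    (h : n j = 0 ∨ ∃ l, l ≠ j ∧ n l ≠ 0) :
    a.act t (Function.update (fun j => (x j).1 1 - (x j).1 0) j (x j).2) = 0 := by
  rcases h with h | ⟨l, hl, h⟩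
  · have := hx j
    rw [h, Cochain.mem_deg_zero] at this
    exact (a.act t).map_coord_zero j (by simp [this])
  · refine (a.act t).map_coord_zero l ?_
    rw [Function.update_of_ne hl]
    have := hx l
    match hn : n l with
    | 0 => exact absurd hn h
    | 1 =>
      rw [hn, Cochain.mem_deg_one] at this
      simp [this]
    | k + 2 =>
      rw [hn, Cochain.mem_deg_add_two] at this
      simp [this]

/-- The exponents are sums of products of degrees in two different positions, so they vanish when at
most one degree is nonzero. -/
theorem koszulSign_eq_one {n : Fin 3 → ℕ} {j : Fin 3} (h : ∀ l, l ≠ j → n l = 0) (i : Fin 3) :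
    Cochain.koszulSign K n i = 1 := by
  have h0 := h 0
  have h1 := h 1
  have h2 := h 2
  fin_cases j <;> fin_cases i <;> simp_all [Cochain.koszulSign]

/-- Position `j` receives its edge value from just two summands: from index `j` with sign plus and
from index `j - 1` with sign minus. The vanishing of these contributions compares consecutive
composites. -/
theorem mem_lieCircRel_iff_circLift (hP : IsBinaryQuadratic P) (r : Tern K (P.obj (Fin 2))) :
    r ∈ lieCircRel P ↔ ∀ i, P.circLift i (r i) = P.circLift (i + 1) (r (i + 1)) := by
  rw [mem_lieCircRel_iff]
  constructor
  · intro h i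
    refine hP.ext fun V _ _ a v => ?_
    -- The 1-cochain sits at the position shared by the summands `i` and `i + 1`. The 0-cochains
    -- vanish at the left vertex, so that their vertex differences are the prescribed `v l`.
    let x : Fin 3 → Cochain V := fun l => if l = i + 1 then (0, v l) else (![0, v l], 0)
    let n : Fin 3 → ℕ := fun l => if l = i + 1 then 1 else 0
    have hx : ∀ l, x l ∈ Cochain.deg K V (n l) := by
      intro l
      by_cases hl : l = i + 1
      · simp only [x, n, if_pos hl]; rfl
      · simp only [x, n, if_neg hl]; rfl
    have hv : Function.update (fun j => (x j).1 1 - (x j).1 0) (i + 1) (x (i + 1)).2 = v := by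
      funext l
      by_cases hl : l = i + 1
      · subst hl; simp [x]
      · simp [x, hl]
    have hk := koszulSign_eq_one (K := K) (n := n) (j := i + 1) (fun l hl => by simp [n, hl])
    have hz : ∀ (t : P.obj (Fin 3)) (j : Fin 3), j ≠ i + 1 →
        a.act t (Function.update (fun j => (x j).1 1 - (x j).1 0) j (x j).2) = 0 :=
      fun t j hj => act_update_eq_zero a hx t j (Or.inl (by simp [n, hj]))
    have := congrArg Prod.snd ((gradedEval_cupBrackets a n x r).symm.trans (h V a n x hx))
    have hi : ∀ i : Fin 3, i ≠ i + 1 := by decide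
    have hi' : ∀ i : Fin 3, i + 2 ≠ i + 1 := by decide
    have hs : ∀ f : Fin 3 → V, ∑ j, f j = f i + f (i + 1) + f (i + 2) := by
      intro f
      fin_cases i <;> simp [Fin.sum_univ_three] <;> abel
    have h3 : ∀ i : Fin 3, i + 2 + 1 = i := by decide
    -- Of the six terms, only the second one of index `i` and the first one of index `i + 1`
    -- survive, both evaluated at `v`.
    simp only [hk, one_smul, hs, hz _ i (hi i), hz _ _ (hi _).symm, hz _ _ (hi' i), h3, hv] at this
    simp only [zero_sub, sub_zero, add_zero, Prod.snd_zero] at this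
    exact (neg_add_eq_zero.mp this)
  · intro h V _ _ a n x hx
    have h1 : P.circLift 1 (r 1) = P.circLift 0 (r 0) := (h 0).symm
    have h2 : P.circLift 2 (r 2) = P.circLift 0 (r 0) := h 2
    rw [gradedEval_cupBrackets]
    refine Prod.ext rfl ?_
    -- Exactly one nonzero degree makes every sign 1; otherwise every term is zero. A single degree
    -- of 2 or more can stay in the first case, since the cancellation there does not use its value.
    by_cases hn : ∃ j, n j ≠ 0 ∧ ∀ l, l ≠ j → n l = 0
    · obtain ⟨j, -, hj⟩ := hn
      have e0 : (2 : Fin 3) + 1 = 0 := rfl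
      have e1 : (1 : Fin 3) + 1 = 2 := rfl
      have e2 : (0 : Fin 3) + 1 = 1 := rfl
      -- With all three composites equal, the cyclic sum telescopes.
      simp only [koszulSign_eq_one hj, one_smul, Fin.sum_univ_three, h1, h2, e0, e1, e2]
      change _ = (0 : V)
      abel
    · have hz : ∀ (t : P.obj (Fin 3)) (j : Fin 3),
          a.act t (Function.update (fun j => (x j).1 1 - (x j).1 0) j (x j).2) = 0 := by
        intro t j
        refine act_update_eq_zero a hx t j ?_
        by_contra! hc
        exact hn ⟨j, hc⟩
      simp only [hz, sub_zero, smul_zero, Finset.sum_const_zero]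
      rfl

end Relations

/-! ### The operad of Lie algebras in arities two and three -/

section Lie

/-- An associative algebra as a model of `lieData`, with the commutator bracket. -/
noncomputable def commutatorModel (K : Type u) [Field K] (R : Type u) [Ring R] [Algebra K R] :
    (lieData K).Model R where
  op := LinearMap.toSpanSingleton K (R →ₗ[K] R →ₗ[K] R)
    (LinearMap.mul K R - (LinearMap.mul K R).flip)
  op_swap e x y := by simp [← smul_neg]
  op_rel r hr x := by
    obtain ⟨c, rfl⟩ := Submodule.mem_span_singleton.mp hr
    rw [map_smul]
    have e0 : (2 : Fin 3) + 1 = 0 := rfl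
    have e1 : (1 : Fin 3) + 1 = 2 := rfl
    have e2 : (1 : Fin 3) + 2 = 0 := rfl
    have e3 : (2 : Fin 3) + 2 = 1 := rfl
    simp only [ternEval, LinearMap.sum_apply]
    simp only [ternTerm, LinearMap.comp_apply, LinearMap.proj_apply,
      TensorProduct.lift.tmul, LinearMap.mk₂_apply, Fin.sum_univ_three,
      LinearMap.toSpanSingleton_apply, one_smul, LinearMap.sub_apply, LinearMap.flip_apply,
      LinearMap.mul_apply', e0, e1, e2, e3, zero_add]
    -- What is multiplied by `c` is the Jacobi expression for commutators.
    convert smul_zero c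
    noncomm_ring

theorem commutatorModel_op (R : Type u) [Ring R] [Algebra K R] (x y : R) :
    (commutatorModel K R).op (1 : K) x y = x * y - y * x := by
  simp [commutatorModel]

variable (K) in
/-- The Lie bracket. -/
noncomputable def lieBracket : (lieData K).operad.obj (Fin 2) := (lieData K).gen (1 : K)

variable (K) in
/-- The iterated bracket `[[x_i, x_{i+1}], x_{i+2}]`. -/
noncomputable def lieBracket₃ (i : Fin 3) : (lieData K).operad.obj (Fin 3) :=
  (lieData K).operad.circ i (lieBracket K) (lieBracket K)

theorem swap_lieBracket : (lieData K).operad.swap (lieBracket K) = -lieBracket K := by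
  rw [lieBracket, QuadData.swap_gen]
  exact map_neg _ _

theorem sum_lieBracket₃ : ∑ i, lieBracket₃ K i = 0 := by
  have := (lieData K).sum_circLift_gen (Submodule.mem_span_singleton_self _)
  simpa [lieBracket₃, lieBracket] using this

theorem exists_smul_lieBracket (p : (lieData K).operad.obj (Fin 2)) :
    ∃ c : K, p = c • lieBracket K := by
  obtain ⟨c, rfl⟩ := (lieData K).gen_surjective p
  refine ⟨c, ?_⟩
  rw [lieBracket, ← map_smul]
  simp

/-- Evaluation of a Lie operation on matrices, followed by taking a matrix entry. -/
noncomputable def matrixEval {A : Type} [Finite A] (v : A → Matrix (Fin 4) (Fin 4) K)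
    (i j : Fin 4) : (lieData K).operad.obj A →ₗ[K] K where
  toFun p := (commutatorModel K (Matrix (Fin 4) (Fin 4) K)).toAlg.act p v i j
  map_add' p q := by simp
  map_smul' c p := by simp

theorem matrixEval_lieBracket (x y : Matrix (Fin 4) (Fin 4) K) (i j : Fin 4) :
    matrixEval ![x, y] i j (lieBracket K) = (x * y - y * x) i j := by
  rw [← commutatorModel_op (K := K), ← QuadData.Model.bin_gen]
  rfl

theorem matrixEval_lieBracket₃ (v : Fin 3 → Matrix (Fin 4) (Fin 4) K) (l : Fin 3) (i j : Fin 4) :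
    matrixEval v i j (lieBracket₃ K l) =
      ((v l * v (l + 1) - v (l + 1) * v l) * v (l + 2) -
        v (l + 2) * (v l * v (l + 1) - v (l + 1) * v l)) i j := by
  change (commutatorModel K (Matrix (Fin 4) (Fin 4) K)).toAlg.act _ v i j = _
  rw [lieBracket₃, SymOperad.Alg.act_circ, lieBracket, QuadData.Model.bin_gen,
    QuadData.Model.bin_gen, commutatorModel_op, commutatorModel_op]

theorem exists_lieBracket_dual :
    ∃ ψ : (lieData K).operad.obj (Fin 2) →ₗ[K] K, ψ (lieBracket K) = 1 := by
  -- For matrix units, `[E_01, E_12] = E_02`.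
  refine ⟨matrixEval ![.single 0 1 1, .single 1 2 1] 0 2, ?_⟩
  rw [matrixEval_lieBracket]
  simp [Matrix.single_mul_single_same, Matrix.single_mul_single_of_ne]

/-- Substituting `E_01`, `E_12`, `E_23` for the variables `i`, `i + 1`, `i + 2`, the three iterated
brackets become `E_03`, `[E_13, E_01] = -E_03`, and 0, because `E_23` and `E_01` commute. The
functional reads off the entry at `(0, 3)`. -/
theorem exists_lieBracket₃_dual (i : Fin 3) :
    ∃ φ : (lieData K).operad.obj (Fin 3) →ₗ[K] K, φ (lieBracket₃ K i) = 1 ∧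
      φ (lieBracket₃ K (i + 1)) = -1 ∧ φ (lieBracket₃ K (i + 2)) = 0 := by
  refine ⟨matrixEval (fun j => if j = i then .single 0 1 1 else
    if j = i + 1 then .single 1 2 1 else .single 2 3 1) 0 3, ?_⟩
  simp only [matrixEval_lieBracket₃]
  fin_cases i <;> refine ⟨?_, ?_, ?_⟩ <;>
    simp [Matrix.single_mul_single_same, Matrix.single_mul_single_of_ne]

end Lie

/-! ### The comparison with the white product -/

section Comparison

variable {P : SymOperad K}

theorem whiteMap_lieBracket (r : Tern K (P.obj (Fin 2))) :
    whiteMap (lieData K).operad P (ternMap (TensorProduct.mk K _ _ (lieBracket K)) r) =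
      ∑ i, lieBracket₃ K i ⊗ₜ[K] P.circLift i (r i) := by
  simp only [whiteMap, ternMap, LinearMap.sum_apply, LinearMap.comp_apply, LinearMap.proj_apply,
    LinearMap.pi_apply]
  refine Finset.sum_congr rfl fun i _ => ?_
  generalize r i = s
  induction s using TensorProduct.induction_on with
  | zero => simp
  | add s t hs ht => simp only [map_add, hs, ht, TensorProduct.tmul_add]
  | tmul p q => simp [lieBracket₃]

/-- A functional with values `1, -1, 0` on the iterated brackets extracts `t i - t (i + 1)` from the
sum. Conversely, a common value of the `t i` factors out and leaves the Jacobi sum. -/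
theorem sum_lieBracket₃_tmul_eq_zero_iff {W : Type u} [AddCommGroup W] [Module K W]
    (t : Fin 3 → W) :
    ∑ i, lieBracket₃ K i ⊗ₜ[K] t i = 0 ↔ ∀ i, t i = t (i + 1) := by
  constructor
  · intro h i
    obtain ⟨φ, h0, h1, h2⟩ := exists_lieBracket₃_dual (K := K) i
    have := congrArg ((TensorProduct.lid K W).toLinearMap ∘ₗ TensorProduct.map φ LinearMap.id) h
    have hs : ∀ f : Fin 3 → W, ∑ j, f j = f i + f (i + 1) + f (i + 2) := by
      intro f
      fin_cases i <;> simp [Fin.sum_univ_three] <;> abel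
    simp only [map_sum, map_zero, LinearMap.comp_apply, TensorProduct.map_tmul,
      LinearEquiv.coe_coe, TensorProduct.lid_tmul, hs, h0, h1, h2, LinearMap.id_apply, one_smul,
      neg_smul, zero_smul, add_zero] at this
    exact add_neg_eq_zero.mp this
  · intro h
    have h1 : t 1 = t 0 := (h 0).symm
    have h2 : t 2 = t 0 := h 2
    have hJ := sum_lieBracket₃ (K := K)
    rw [Fin.sum_univ_three] at hJ
    rw [Fin.sum_univ_three, h1, h2, ← TensorProduct.add_tmul, ← TensorProduct.add_tmul, hJ,
      TensorProduct.zero_tmul]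

/-- Both memberships say that the three composites of `r` in `P(3)` coincide. -/
theorem ternMap_mem_whiteData_rel_iff (hP : IsBinaryQuadratic P) (r : Tern K (P.obj (Fin 2))) :
    ternMap (TensorProduct.mk K _ _ (lieBracket K)) r ∈ (whiteData (lieData K).operad P).rel ↔
      r ∈ lieCircRel P := by
  rw [LinearMap.mem_ker, whiteMap_lieBracket, sum_lieBracket₃_tmul_eq_zero_iff,
    mem_lieCircRel_iff_circLift hP]

variable (P) in
-- `Lie(2)` is spanned by the bracket, and a functional equal to 1 on the bracket contracts the
-- first tensor factor.
theorem exists_mk_lieBracket_inverse :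
    ∃ g : (lieData K).operad.obj (Fin 2) ⊗[K] P.obj (Fin 2) →ₗ[K] P.obj (Fin 2),
      g ∘ₗ TensorProduct.mk K _ _ (lieBracket K) = LinearMap.id ∧
        TensorProduct.mk K _ _ (lieBracket K) ∘ₗ g = LinearMap.id := by
  obtain ⟨ψ, hψ⟩ := exists_lieBracket_dual (K := K)
  refine ⟨(TensorProduct.lid K _).toLinearMap ∘ₗ TensorProduct.map ψ LinearMap.id, ?_, ?_⟩
  · ext p
    simp [hψ]
  · refine TensorProduct.ext' fun q p => ?_
    obtain ⟨c, rfl⟩ := exists_smul_lieBracket q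
    simp [hψ, TensorProduct.smul_tmul]

/-- The morphism of quadratic data sending the cup bracket of `p` to `[-, -] ⊗ p`. -/
noncomputable def lieCircToWhite (hP : IsBinaryQuadratic P) :
    lieCircData P ⟶ whiteData (lieData K).operad P :=
  QuadData.Hom.mk (TensorProduct.mk K _ _ (lieBracket K))
    (fun e => by
      -- The sign from the antisymmetry of the Lie bracket matches the sign twist on the cup
      -- brackets.
      simp [swap_lieBracket, TensorProduct.neg_tmul, TensorProduct.tmul_neg])
    (fun r hr => (ternMap_mem_whiteData_rel_iff hP r).mpr hr)

/-- Bijectivity on generators alone would not suffice: the inverse must also preserve relations,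
which is the other direction of `ternMap_mem_whiteData_rel_iff`. -/
theorem isIso_lieCircToWhite (hP : IsBinaryQuadratic P) : IsIso (lieCircToWhite hP) := by
  obtain ⟨g, hg, hg'⟩ := exists_mk_lieBracket_inverse P
  refine ⟨QuadData.Hom.mk g (fun e => ?_) (fun r hr => ?_), QuadData.Hom.ext hg,
    QuadData.Hom.ext hg'⟩
  · have h := (lieCircToWhite hP).lin_swap (g e)
    have := congrArg g h
    have h1 : (lieCircToWhite hP).lin (g e) = e := LinearMap.congr_fun hg' e
    rw [h1] at this
    exact this.symm.trans (LinearMap.congr_fun hg _)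
  · refine (ternMap_mem_whiteData_rel_iff hP _).mp ?_
    rw [← QuadData.ternMap_comp_apply, hg', ternMap_id]
    exact hr

variable (K) in
/-- The natural isomorphism of quadratic data between `Lie_∘(P)` and the white product of the operad
of Lie algebras with `P`. -/
noncomputable def lieCircDataIso :
    lieCircDataFunctor K ≅ whiteDataFunctor (lieOperad K) :=
  NatIso.ofComponents
    (fun P => @asIso _ _ _ _ (lieCircToWhite P.property) (isIso_lieCircToWhite P.property))
    -- Both functors act on generators through the arity 2 part of the morphism and leave the Lie
    -- bracket factor fixed.
    (fun _ => QuadData.Hom.ext rfl)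

/-- Isomorphic constructions of quadratic data give isomorphic constructions of operads. -/
noncomputable def presentedFunctorIso {F G : BQOp K ⥤ QuadData K} (α : F ≅ G)
    (hF : ∀ P, Module.Finite K (F.obj P).E) (hG : ∀ P, Module.Finite K (G.obj P).E) :
    presentedFunctor F hF ≅ presentedFunctor G hG :=
  -- The isomorphism is built between functors to all operads, then lifted through the inclusion of
  -- the full subcategory.
  (IsBinaryQuadratic (K := K)).fullyFaithfulι.whiskeringRight _ |>.preimageIso
    (Functor.isoWhiskerRight α (QuadData.presented K))

end Comparison

end Manin

theorem theorem2p12 (K : Type u) [Field K] :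
    Nonempty (Manin.lieCirc K ≅ Manin.whiteProduct (Manin.lieOperad K)) :=
  ⟨Manin.presentedFunctorIso (Manin.lieCircDataIso K) _ _⟩
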